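/- Let $I\subseteq\mathbb R$ be a nonempty open interval, $V\subseteq\mathbb R^3$ a nonempty connected open set, and $g=-dt^2+A(t)^2dx^2+B(t)^2dy^2+C(t)^2dz^2$ on $I\times V$ with $A,B,C$ smooth and nowhere zero on $I$ (a Bianchi I metric). Such a metric is called LRS if two of its spatial coefficients are constant multiples of each other, i.e. equal after a constant rescaling of $x,y,z$, and conformally flat if its Weyl tensor vanishes identically. A conformal Killing vector (CKV) with conformal factor $\psi$ is a smooth vector field $X$ with $\mathcal L_Xg=2\psi g$. It is a Killing vector (KV) if $\psi=0$, a proper homothetic vector (HV) if $\psi$ is a nonzero constant, and a proper CKV if $\psi$ is not constant. **(1)** Suppose that $g$ is neither LRS nor conformally flat. If $g$ admits a proper CKV on $I\times V$, then, after a change of the time coordinate $\tau=\theta(t)$ ($\theta$ smooth, $\theta'\neq0$), a permutation of $x,y,z$ and a constant nonzero rescaling of each of them, $g$ takes one of the following two forms, where $C$ is now a smooth nowhere vanishing function of $\tau$ on the interval concerned: $$B_1:\quad C(\tau)^2\left[-d\tau^2+e^{-2\tau/c}dx^2+e^{-2\alpha_1\tau/c}dy^2+dz^2\right],\qquad c\neq0,\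 \alpha_1\neq0,1;$$ $$B_2:\quad C(\tau)^2\left[-d\tau^2+\tau^{2(\alpha_2-1)/\alpha_2}dx^2+\tau^{2(\alpha_2-\alpha_1)/\alpha_2}dy^2+dz^2\right]\ (\tau>0),\qquad \alpha_2\neq0,1,\ \alpha_1\neq\alpha_2,\ \alpha_1\neq1.$$ Moreover $g$ admits a proper HV if and only if its coefficients are power laws, i.e. there are a number $t_0\notin I$ and constants such that $A=a|t-t_0|^p$, $B=b|t-t_0|^q$, $C=\tilde c\,|t-t_0|^r$ on $I$. **(2)** Conversely, for all admissible values of the parameters, every nonempty open interval $J$ of values of $\tau$ (with $J\subseteq(0,\infty)$ for $B_2$), every nonempty connected open $V\subseteq\mathbb R^3$ and every smooth nowhere vanishing $C$ on $J$, the metric $B_1$ (resp. $B_2$) on $J\times V$ is neither LRS nor conformally flat. It has the CKV $$X_{B_1}=c\,\partial_\tau+x\,\partial_x+\alpha_1y\,\partial_y,\quad \psi(X_{B_1})=c\,(\ln|C|)_{,\tau},$$ resp. $$X_{B_2}=\alpha_2\tau\,\partial_\tau+x\,\partial_x+\alpha_1y\,\partial_y+\alpha_2z\,\partial_z,\quad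 \psi(X_{B_2})=\alpha_2\left[1+\tau(\ln|C|)_{,\tau}\right],$$ and its CKVs are exactly the fields $\mu X_{B_i}+\kappa_1\partial_x+\kappa_2\partial_y+\kappa_3\partial_z$ with constant $\mu,\kappa_1,\kappa_2,\kappa_3$, the conformal factor being $\mu\,\psi(X_{B_i})$. In particular, whenever $\psi(X_{B_i})$ is not constant, $X_{B_i}$ is a proper CKV, and it is the only one up to nonzero constant multiples and the addition of the translations. The field $X_{B_1}$ is a proper HV if and only if $C(\tau)=k\,e^{\psi_0\tau}$ on $J$ for constants $k$ and $\psi_0\neq0$, and $X_{B_2}$ is a proper HV if and only if $C(\tau)=k\,\tau^{\psi_0-1}$ on $J$ for constants $k$ and $\psi_0\neq0$. -/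

import Mathlib

open Set
open scoped ContDiff

noncomputable section

namespace BianchiI

/-- Coordinate space: coordinate `0` is time, coordinates `1, 2, 3` are `x, y, z`. -/
abbrev Pt := Fin 4 → ℝ

/-- A metric in coordinates, given by its matrix of components `g p a b`. -/
abbrev Metric := Pt → Matrix (Fin 4) (Fin 4) ℝ

/-- The partial derivative `∂ᵢ f` at `p`. -/
def pd (i : Fin 4) (f : Pt → ℝ) (p : Pt) : ℝ := fderiv ℝ f p (Pi.single i 1)

/-! ### Curvature and conformal flatness -/

/-- Christoffel symbols `Γ^i_{jk}`. -/
def christoffel (g : Metric) (i j k : Fin 4) (p : Pt) : ℝ :=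
  (1 / 2) * ∑ l, (g p)⁻¹ i l *
    (pd j (fun q => g q l k) p + pd k (fun q => g q l j) p - pd l (fun q => g q j k) p)

/-- Riemann tensor `R^i_{jkl} = ∂ₖΓ^i_{lj} - ∂ₗΓ^i_{kj} + Γ^i_{km}Γ^m_{lj} - Γ^i_{lm}Γ^m_{kj}`. -/
def riemannUp (g : Metric) (i j k l : Fin 4) (p : Pt) : ℝ :=
  pd k (christoffel g i l j) p - pd l (christoffel g i k j) p
    + ∑ m, (christoffel g i k m p * christoffel g m l j p
        - christoffel g i l m p * christoffel g m k j p)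

/-- Riemann tensor with all indices lowered, `R_{ijkl}`. -/
def riemann (g : Metric) (i j k l : Fin 4) (p : Pt) : ℝ :=
  ∑ m, g p i m * riemannUp g m j k l p

/-- Ricci tensor `R_{jl} = R^k_{jkl}`. -/
def ricci (g : Metric) (j l : Fin 4) (p : Pt) : ℝ := ∑ k, riemannUp g k j k l p

/-- Scalar curvature. -/
def scalarCurv (g : Metric) (p : Pt) : ℝ := ∑ j, ∑ l, (g p)⁻¹ j l * ricci g j l p

/-- Weyl tensor `C_{ijkl}` in dimension four. -/
def weyl (g : Metric) (i j k l : Fin 4) (p : Pt) : ℝ :=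
  riemann g i j k l p
    - (1 / 2) * (g p i k * ricci g j l p - g p i l * ricci g j k p
        - g p j k * ricci g i l p + g p j l * ricci g i k p)
    + scalarCurv g p / 6 * (g p i k * g p j l - g p i l * g p j k)

/-- `g` is conformally flat on `U`: its Weyl tensor vanishes identically there. -/
def ConformallyFlatOn (g : Metric) (U : Set Pt) : Prop :=
  ∀ p ∈ U, ∀ i j k l, weyl g i j k l p = 0

/-! ### Conformal Killing vectors -/

/-- Lie derivative `(L_X g)_{ab} = X^k ∂ₖ g_{ab} + g_{kb} ∂ₐ X^k + g_{ak} ∂_b X^k`. -/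
def lieDeriv (X : Pt → Pt) (g : Metric) (a b : Fin 4) (p : Pt) : ℝ :=
  ∑ k, (X p k * pd k (fun q => g q a b) p + g p k b * pd a (fun q => X q k) p
    + g p a k * pd b (fun q => X q k) p)

/-- `X` is a smooth vector field on `U` with `L_X g = 2 ψ g` there. -/
def IsCKV (g : Metric) (U : Set Pt) (X : Pt → Pt) (ψ : Pt → ℝ) : Prop :=
  ContDiffOn ℝ ∞ X U ∧ ∀ p ∈ U, ∀ a b, lieDeriv X g a b p = 2 * ψ p * g p a b

/-- A proper CKV: a CKV whose conformal factor is not constant. -/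
def IsProperCKV (g : Metric) (U : Set Pt) (X : Pt → Pt) : Prop :=
  ∃ ψ, IsCKV g U X ψ ∧ ¬ ∃ k : ℝ, ∀ p ∈ U, ψ p = k

/-- A proper homothetic vector: a CKV whose conformal factor is a nonzero constant. -/
def IsProperHV (g : Metric) (U : Set Pt) (X : Pt → Pt) : Prop :=
  ∃ k : ℝ, k ≠ 0 ∧ IsCKV g U X (fun _ => k)

/-- The translation field `κ₀ ∂_x + κ₁ ∂_y + κ₂ ∂_z`. -/
def translation (κ : Fin 3 → ℝ) : Pt := ![0, κ 0, κ 1, κ 2]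

/-! ### Bianchi I metrics -/

/-- A nonempty open interval of the real line, bounded or not. -/
def IsOpenInterval (I : Set ℝ) : Prop := IsOpen I ∧ I.OrdConnected ∧ I.Nonempty

/-- The region `I × V`: time in `I`, spatial coordinates in `V`. -/
def region (I : Set ℝ) (V : Set (Fin 3 → ℝ)) : Set Pt :=
  {p | p 0 ∈ I ∧ (fun i : Fin 3 => p i.succ) ∈ V}

/-- `-dt² + A(t)² dx² + B(t)² dy² + C(t)² dz²`. -/
def bianchiMetric (A B C : ℝ → ℝ) : Metric := fun p =>
  Matrix.diagonal ![-1, A (p 0) ^ 2, B (p 0) ^ 2, C (p 0) ^ 2]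

/-- A smooth function without zeros on `I`. -/
def IsScaleFactor (I : Set ℝ) (f : ℝ → ℝ) : Prop :=
  ContDiffOn ℝ ∞ f I ∧ ∀ t ∈ I, f t ≠ 0

/-- A diagonal metric depending on time only is LRS if two of the spatial coefficients agree after
a constant rescaling of the spatial coordinates. -/
def IsLRSOn (g : Metric) (U : Set Pt) : Prop :=
  ∃ i j : Fin 3, i ≠ j ∧ ∃ k : ℝ, ∀ p ∈ U, g p i.succ i.succ = k * g p j.succ j.succ

/-! ### The two families -/

/-- `C(τ)² [-dτ² + e^{-2τ/c} dx² + e^{-2α₁τ/c} dy² + dz²]`. -/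
def metricB1 (c α₁ : ℝ) (C : ℝ → ℝ) : Metric := fun p =>
  C (p 0) ^ 2 • Matrix.diagonal
    ![-1, Real.exp (-(2 / c) * p 0), Real.exp (-(2 * α₁ / c) * p 0), 1]

/-- `c ∂_τ + x ∂_x + α₁ y ∂_y`. -/
def fieldB1 (c α₁ : ℝ) : Pt → Pt := fun p => ![c, p 1, α₁ * p 2, 0]

/-- `c (ln |C|)_{,τ}`. -/
def factorB1 (c : ℝ) (C : ℝ → ℝ) : Pt → ℝ := fun p =>
  c * deriv (fun s => Real.log |C s|) (p 0)

/-- `C(τ)² [-dτ² + τ^{2(α₂-1)/α₂} dx² + τ^{2(α₂-α₁)/α₂} dy² + dz²]`, for `τ > 0`. -/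
def metricB2 (α₁ α₂ : ℝ) (C : ℝ → ℝ) : Metric := fun p =>
  C (p 0) ^ 2 • Matrix.diagonal
    ![-1, (p 0) ^ (2 * ((α₂ - 1) / α₂)), (p 0) ^ (2 * ((α₂ - α₁) / α₂)), 1]

/-- `α₂ τ ∂_τ + x ∂_x + α₁ y ∂_y + α₂ z ∂_z`. -/
def fieldB2 (α₁ α₂ : ℝ) : Pt → Pt := fun p => ![α₂ * p 0, p 1, α₁ * p 2, α₂ * p 3]

/-- `α₂ [1 + τ (ln |C|)_{,τ}]`. -/
def factorB2 (α₂ : ℝ) (C : ℝ → ℝ) : Pt → ℝ := fun p =>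
  α₂ * (1 + p 0 * deriv (fun s => Real.log |C s|) (p 0))

/-- Admissible parameters of the first family. -/
def ParamsB1 (c α₁ : ℝ) : Prop := c ≠ 0 ∧ α₁ ≠ 0 ∧ α₁ ≠ 1

/-- Admissible parameters of the second family. -/
def ParamsB2 (α₁ α₂ : ℝ) : Prop := α₂ ≠ 0 ∧ α₂ ≠ 1 ∧ α₁ ≠ α₂ ∧ α₁ ≠ 1

/-! ### Belonging to a family, up to a change of coordinates -/

/-- Pullback `(Φ^* g)_{ab} = ∂ₐΦ^i ∂_bΦ^j g_{ij} ∘ Φ`. -/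
def pullback (Φ : Pt → Pt) (g : Metric) : Metric := fun p =>
  Matrix.of fun a b => ∑ i, ∑ j, pd a (fun q => Φ q i) p * pd b (fun q => Φ q j) p * g (Φ p) i j

/-- The change of coordinates consisting of a new time `τ = θ(t)`, a relabelling `σ` of the spatial
axes and a rescaling by `k i` of the `i`-th new spatial coordinate. -/
def coordChange (θ : ℝ → ℝ) (σ : Equiv.Perm (Fin 3)) (k : Fin 3 → ℝ) : Pt → Pt := fun p =>
  ![θ (p 0), k 0 * p (σ 0).succ, k 1 * p (σ 1).succ, k 2 * p (σ 2).succ]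

/-- On the time interval `I` the metric `g` becomes `h` after a change of coordinates as above;
`θ` is a diffeomorphism of `I` onto the interval `θ '' I`. -/
def TransformsTo (I : Set ℝ) (g h : Metric) (θ : ℝ → ℝ) : Prop :=
  ContDiffOn ℝ ∞ θ I ∧ (∀ t ∈ I, deriv θ t ≠ 0) ∧
    ∃ (σ : Equiv.Perm (Fin 3)) (k : Fin 3 → ℝ), (∀ i, k i ≠ 0) ∧
      ∀ p : Pt, p 0 ∈ I → pullback (coordChange θ σ k) h p = g p

/-- `g` is, on the time interval `I`, a member of the first family. -/
def BelongsB1 (I : Set ℝ) (g : Metric) : Prop :=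
  ∃ (c α₁ : ℝ) (C θ : ℝ → ℝ), ParamsB1 c α₁ ∧ IsScaleFactor (θ '' I) C ∧
    TransformsTo I g (metricB1 c α₁ C) θ

/-- `g` is, on the time interval `I`, a member of the second family. -/
def BelongsB2 (I : Set ℝ) (g : Metric) : Prop :=
  ∃ (α₁ α₂ : ℝ) (C θ : ℝ → ℝ), ParamsB2 α₁ α₂ ∧ θ '' I ⊆ Ioi 0 ∧ IsScaleFactor (θ '' I) C ∧
    TransformsTo I g (metricB2 α₁ α₂ C) θ

/-- `X` is, up to nonzero constant multiples and the addition of translations, the only CKV of `g`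
on `U` besides the translations, and its conformal factor is `ψ`; in particular, if `ψ` is not
constant then `X` is a proper CKV and every other one is `μ X + translation` with `μ ≠ 0`. -/
def HasUniqueCKV (g : Metric) (U : Set Pt) (X : Pt → Pt) (ψ : Pt → ℝ) : Prop :=
  IsCKV g U X ψ ∧
  (∀ (Y : Pt → Pt) (φ : Pt → ℝ), IsCKV g U Y φ ↔
    ∃ (μ : ℝ) (κ : Fin 3 → ℝ), ∀ p ∈ U, Y p = μ • X p + translation κ ∧ φ p = μ * ψ p) ∧
  ((¬ ∃ k : ℝ, ∀ p ∈ U, ψ p = k) →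
    IsProperCKV g U X ∧ ∀ Y, IsProperCKV g U Y →
      ∃ (μ : ℝ) (κ : Fin 3 → ℝ), μ ≠ 0 ∧ ∀ p ∈ U, Y p = μ • X p + translation κ)

/-- All three scale factors are constant multiples of powers of `|t - t₀|` on `I`. -/
def IsPowerLaw (I : Set ℝ) (A B C : ℝ → ℝ) : Prop :=
  ∃ t₀ ∉ I, ∃ a b c p q r : ℝ, ∀ t ∈ I,
    A t = a * |t - t₀| ^ p ∧ B t = b * |t - t₀| ^ q ∧ C t = c * |t - t₀| ^ r

end BianchiI

end

/-! For a diagonal metric depending on time only, let `H_i` be half the logarithmic derivative of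
the `i`-th entry (`rate`). The Weyl tensor is diagonal on coordinate bivectors, and it vanishes
exactly when `weylDiff`, that is `(H_i - H_j)' + (H_i - H_j)(H_i + H_j - H_k - H_0)`, vanishes for
distinct spatial `i, j, k`. Not being LRS means that no two spatial rates agree on all of `I`.

The core is a rigidity statement. For a CKV `X`, the shears `∂_j X^i` and the mixed second
derivatives `∂_i ∂_j X^0` obey scalar linear homogeneous equations along time lines, and each is
annihilated by some `weylDiff`. A nonzero shear would force the metric to be LRS or conformally flat
(`CKVSystem.shear_eq_zero`). Once the shears are gone, so is the spatial gradient of `X^0`, and `X =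
F(t) ∂_t + ∑ (α_i x_i + κ_i) ∂_i` with `F' = (H_i - H_0) F + α_i` for every spatial `i`
(`IsCKV.exists_diagonalCKV`).

For Bianchi I metrics `H_0 = 0`, and either `F` vanishes identically or it has no zeros and the
`α_i` are distinct (`DiagonalCKV.trivial_or_ne_zero`). In the second case the logarithmic derivative
of `a_i / a_3` is `(α_3 - α_i) / F`. If `α_3 = 0`, then `F` is a constant multiple of `a_3`, so
these ratios are exponentials of conformal time: the first family. If `α_3 ≠ 0`, then `F / (α_3
a_3)` is itself a conformal time, and the ratios are powers of it: the second family. A proper HV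
has `F' = ψ` constant, so `F = k (t - t₀)` and the coefficients are power laws.

Conversely, the rates of the families are `C'/C` plus constants, respectively constants over `τ`.
The equations for `(F, α)` are then solved algebraically, and their solutions form a line. -/

namespace BianchiI

/-! ### Calculus of partial derivatives -/

section PartialDerivatives

variable {U : Set Pt} {f g : Pt → ℝ} {p : Pt}

theorem differentiableAt_of_smoothOn (hU : IsOpen U) (hf : ContDiffOn ℝ ∞ f U) (hp : p ∈ U) :
    DifferentiableAt ℝ f p :=
  (hf.contDiffAt (hU.mem_nhds hp)).differentiableAt (by simp)

theorem pd_congr (hU : IsOpen U) (hfg : ∀ q ∈ U, f q = g q) (hp : p ∈ U) (i : Fin 4) :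
    pd i f p = pd i g p := by
  have : f =ᶠ[nhds p] g := by
    filter_upwards [hU.mem_nhds hp] with q hq using hfg q hq
  simp only [pd, this.fderiv_eq]

theorem contDiffOn_pd (hU : IsOpen U) (hf : ContDiffOn ℝ ∞ f U) (i : Fin 4) :
    ContDiffOn ℝ ∞ (pd i f) U := by
  have h := hf.fderiv_of_isOpen (m := ∞) hU (by simp)
  exact h.clm_apply contDiffOn_const

theorem pd_comm (hU : IsOpen U) (hf : ContDiffOn ℝ ∞ f U) (hp : p ∈ U) (i j : Fin 4) :
    pd i (pd j f) p = pd j (pd i f) p := by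
  have hs : IsSymmSndFDerivAt ℝ f p :=
    (hf.contDiffAt (hU.mem_nhds hp)).isSymmSndFDerivAt (by
      simpa using (show ((2 : ℕ∞) : WithTop ℕ∞) ≤ ((⊤ : ℕ∞) : WithTop ℕ∞) from by
        exact_mod_cast le_top))
  have hd : DifferentiableAt ℝ (fderiv ℝ f) p :=
    (((hf.fderiv_of_isOpen (m := ∞) hU (by simp)).contDiffAt
      (hU.mem_nhds hp)).differentiableAt (by simp))
  have key : ∀ a b : Fin 4, pd a (pd b f) p
      = fderiv ℝ (fderiv ℝ f) p (Pi.single a 1) (Pi.single b 1) := by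
    intro a b
    have : HasFDerivAt (fun q => fderiv ℝ f q (Pi.single b 1 : Pt))
        ((fderiv ℝ (fderiv ℝ f) p).flip (Pi.single b 1)) p := by
      simpa using hd.hasFDerivAt.clm_apply (hasFDerivAt_const (Pi.single b 1 : Pt) p)
    change fderiv ℝ (fun q => fderiv ℝ f q (Pi.single b 1 : Pt)) p _ = _
    rw [this.fderiv]; rfl
  rw [key, key]; exact hs.eq _ _

theorem pd_add (hf : DifferentiableAt ℝ f p) (hg : DifferentiableAt ℝ g p) (i : Fin 4) :
    pd i (fun q => f q + g q) p = pd i f p + pd i g p := by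
  simp [pd, fderiv_fun_add hf hg]

theorem pd_sub (hf : DifferentiableAt ℝ f p) (hg : DifferentiableAt ℝ g p) (i : Fin 4) :
    pd i (fun q => f q - g q) p = pd i f p - pd i g p := by
  simp [pd, fderiv_fun_sub hf hg]

theorem pd_mul (hf : DifferentiableAt ℝ f p) (hg : DifferentiableAt ℝ g p) (i : Fin 4) :
    pd i (fun q => f q * g q) p = pd i f p * g p + f p * pd i g p := by
  simp [pd, fderiv_fun_mul hf hg]; ring

@[simp] theorem pd_const (c : ℝ) (i : Fin 4) (p : Pt) : pd i (fun _ => c) p = 0 := by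
  simp [pd]

theorem hasFDerivAt_coord (j : Fin 4) (p : Pt) :
    HasFDerivAt (fun q : Pt => q j) (ContinuousLinearMap.proj (R := ℝ) (φ := fun _ => ℝ) j) p :=
  (ContinuousLinearMap.proj (R := ℝ) (φ := fun _ : Fin 4 => ℝ) j).hasFDerivAt

theorem pd_comp_coord {h : ℝ → ℝ} (i j : Fin 4) (hh : DifferentiableAt ℝ h (p j)) :
    pd i (fun q => h (q j)) p = if i = j then deriv h (p j) else 0 := by
  have : HasFDerivAt (fun q : Pt => h (q j)) _ p :=
    hh.hasDerivAt.comp_hasFDerivAt p (hasFDerivAt_coord j p)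
  rw [pd, this.fderiv]
  by_cases hij : i = j
  · subst hij; simp
  · simp [hij, Ne.symm hij]

theorem fderiv_eq_zero_of_pd (hf : ∀ i, pd i f p = 0) : fderiv ℝ f p = 0 := by
  ext v
  have hv : v = ∑ i, v i • (Pi.single i 1 : Pt) := by
    simpa using (pi_eq_sum_univ' v)
  rw [hv, map_sum]
  simp only [map_smul]
  have : ∀ i, fderiv ℝ f p (Pi.single i 1) = 0 := hf
  simp [this]

theorem exists_eq_const_of_pd (hU : IsOpen U) (hU' : IsPreconnected U) (hf : ContDiffOn ℝ ∞ f U)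
    (h : ∀ p ∈ U, ∀ i, pd i f p = 0) : ∃ c, ∀ p ∈ U, f p = c :=
  hU.exists_is_const_of_fderiv_eq_zero hU' (hf.differentiableOn (by simp))
    fun p hp => fderiv_eq_zero_of_pd (h p hp)

end PartialDerivatives

/-! ### The region `I × V` and its time lines -/

section Region

variable {I : Set ℝ} {V : Set (Fin 3 → ℝ)} {p : Pt}

theorem IsOpenInterval.isPreconnected (hI : IsOpenInterval I) : IsPreconnected I :=
  hI.2.1.isPreconnected

theorem isOpen_region (hI : IsOpen I) (hV : IsOpen V) : IsOpen (region I V) :=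
  (hI.preimage (continuous_apply 0)).inter
    (hV.preimage (continuous_pi fun i => continuous_apply i.succ))

theorem cons_mem_region {t : ℝ} {x : Fin 3 → ℝ} (ht : t ∈ I) (hx : x ∈ V) :
    (Fin.cons t x : Pt) ∈ region I V := by
  exact ⟨by simpa using ht, by simpa using hx⟩

theorem isPreconnected_region (hI : IsPreconnected I) (hV : IsPreconnected V) :
    IsPreconnected (region I V) := by
  have : region I V = (fun q : ℝ × (Fin 3 → ℝ) => (Fin.cons q.1 q.2 : Pt)) '' (I ×ˢ V) := by
    ext p
    constructor
    · intro hp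
      exact ⟨(p 0, Fin.tail p), ⟨hp.1, hp.2⟩, Fin.cons_self_tail p⟩
    · rintro ⟨q, hq, rfl⟩
      exact cons_mem_region hq.1 hq.2
  rw [this]
  refine (hI.prod hV).image _ (Continuous.continuousOn (continuous_pi fun i => ?_))
  refine Fin.cases ?_ (fun j => ?_) i
  · simpa using continuous_fst
  · simp only [Fin.cons_succ]
    fun_prop

theorem update_mem_region (hp : p ∈ region I V) {t : ℝ} (ht : t ∈ I) :
    Function.update p 0 t ∈ region I V := by
  refine ⟨by simpa using ht, ?_⟩
  have : (fun i : Fin 3 => Function.update p 0 t i.succ) = fun i => p i.succ := by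
    funext i; simp [Function.update, Fin.succ_ne_zero]
  exact this ▸ hp.2

theorem hasDerivAt_timeLine {f : Pt → ℝ} {t : ℝ}
    (hf : DifferentiableAt ℝ f (Function.update p 0 t)) :
    HasDerivAt (fun s => f (Function.update p 0 s)) (pd 0 f (Function.update p 0 t)) t :=
  hf.hasFDerivAt.comp_hasDerivAt t (hasDerivAt_update p 0 t)

end Region

/-! ### Functions of time -/

section Time

variable {I : Set ℝ} {y h : ℝ → ℝ}

theorem eqOn_const_of_hasDerivAt (hI : IsOpenInterval I) (hy : ∀ t ∈ I, HasDerivAt y 0 t) :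
    ∃ c, ∀ t ∈ I, y t = c :=
  hI.1.exists_is_const_of_deriv_eq_zero hI.isPreconnected
    (fun t ht => (hy t ht).differentiableAt.differentiableWithinAt) fun t ht => (hy t ht).deriv

/-- A solution of a scalar linear homogeneous equation with a zero vanishes identically. -/
theorem eq_zero_of_linear_ode (hI : IsOpenInterval I) (hh : ContinuousOn h I)
    (hy : ∀ t ∈ I, HasDerivAt y (h t * y t) t) {t₀ : ℝ} (ht₀ : t₀ ∈ I) (h0 : y t₀ = 0) :
    ∀ t ∈ I, y t = 0 := by
  have hF : ∀ t ∈ I, HasDerivAt (fun t => ∫ s in t₀..t, h s) (h t) t := by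
    intro t ht
    have hsub : uIcc t₀ t ⊆ I := hI.2.1.uIcc_subset ht₀ ht
    exact intervalIntegral.integral_hasDerivAt_right
      ((hh.mono hsub).intervalIntegrable)
      (hh.stronglyMeasurableAtFilter hI.1 t ht) (hh.continuousAt (hI.1.mem_nhds ht))
  -- The integrating factor `exp (-∫ h)` turns `y` into a constant.
  obtain ⟨c, hc⟩ := eqOn_const_of_hasDerivAt (y := fun t => y t * Real.exp (-∫ s in t₀..t, h s)) hI
    (by
      intro t ht
      have := (hy t ht).mul ((hF t ht).neg.exp)
      refine this.congr_deriv ?_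
      ring)
  have hc0 : c = 0 := by rw [← hc t₀ ht₀, h0, zero_mul]
  intro t ht
  have := hc t ht
  rw [hc0] at this
  exact (mul_eq_zero.mp this).resolve_right (Real.exp_ne_zero _)

theorem hasDerivAt_of_smoothOn {f : ℝ → ℝ} (hI : IsOpen I) (hf : ContDiffOn ℝ ∞ f I) {t : ℝ}
    (ht : t ∈ I) : HasDerivAt f (deriv f t) t :=
  ((hf.contDiffAt (hI.mem_nhds ht)).differentiableAt (by simp)).hasDerivAt

theorem contDiffOn_deriv {f : ℝ → ℝ} (hI : IsOpen I) (hf : ContDiffOn ℝ ∞ f I) :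
    ContDiffOn ℝ ∞ (deriv f) I :=
  ((contDiffOn_infty_iff_deriv_of_isOpen hI).1 hf).2

/-- Linear homogeneous equations along the time lines of `I × V`. -/
theorem eq_zero_of_linear_pd {V : Set (Fin 3 → ℝ)} {R : Pt → ℝ} {p : Pt} (hI : IsOpenInterval I)
    (hV : IsOpen V) (hR : ContDiffOn ℝ ∞ R (region I V)) (hh : ContinuousOn h I)
    (hode : ∀ q ∈ region I V, pd 0 R q = h (q 0) * R q) (hp : p ∈ region I V) {t₀ : ℝ}
    (ht₀ : t₀ ∈ I) (h0 : R (Function.update p 0 t₀) = 0) : R p = 0 := by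
  have := eq_zero_of_linear_ode (y := fun t => R (Function.update p 0 t)) hI hh
    (fun t ht => by
      have hq := update_mem_region hp ht
      have := hasDerivAt_timeLine (differentiableAt_of_smoothOn (isOpen_region hI.1 hV) hR hq)
      rw [hode _ hq] at this
      simpa using this) ht₀ h0 (p 0) hp.1
  simpa using this

end Time

/-! ### Curvature of diagonal metrics depending on time only -/

/-- The diagonal metric with diagonal entries `G i`, functions of time. -/
def diagMetric (G : Fin 4 → ℝ → ℝ) : Metric := fun p => Matrix.diagonal fun i => G i (p 0)

/-- Half the logarithmic derivative of a diagonal entry. -/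
noncomputable def rate (G : Fin 4 → ℝ → ℝ) (i : Fin 4) (t : ℝ) : ℝ := deriv (G i) t / (2 * G i t)

/-- The Christoffel symbols of `diagMetric G` in terms of the values `G`, `H` of the entries and
of their rates. -/
noncomputable def conn (G H : Fin 4 → ℝ) (i j k : Fin 4) : ℝ :=
  if i = k ∧ j = 0 then H i else if i = j ∧ k = 0 then H i
  else if j = k ∧ i = 0 then -(H j * G j / G 0) else 0

/-- The time derivative of `conn`, where `D` stands for the derivatives of the rates. -/
noncomputable def connDeriv (G H D : Fin 4 → ℝ) (i j k : Fin 4) : ℝ :=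
  if i = k ∧ j = 0 then D i else if i = j ∧ k = 0 then D i
  else if j = k ∧ i = 0 then -(G j / G 0 * (D j + 2 * H j ^ 2 - 2 * H j * H 0)) else 0

/-- Sectional curvatures of the coordinate planes. -/
noncomputable def sec (G H D : Fin 4 → ℝ) (i j : Fin 4) : ℝ :=
  if i = j then 0 else if i = 0 then -(D j + H j ^ 2 - H 0 * H j) / G 0
  else if j = 0 then -(D i + H i ^ 2 - H 0 * H i) / G 0 else -(H i * H j) / G 0

/-- The operator `C_{ijij} / (g_{ii} g_{jj})` of the Weyl tensor. -/
noncomputable def weylSec (G H D : Fin 4 → ℝ) (i j : Fin 4) : ℝ :=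
  sec G H D i j - (1 / 2) * (∑ k, sec G H D k i + ∑ k, sec G H D k j)
    + (∑ l, ∑ k, sec G H D k l) / 6

/-- The difference of two eigenvalues of the Weyl tensor, up to a nonzero factor. -/
noncomputable def weylDiff (G : Fin 4 → ℝ → ℝ) (i j k : Fin 4) (t : ℝ) : ℝ :=
  deriv (rate G i) t - deriv (rate G j) t
    + (rate G i t - rate G j t) * (rate G i t + rate G j t - rate G k t - rate G 0 t)

/-- The Riemann formula becomes a rational identity in the formal values `G`, `H`, `D`, because only
time derivatives survive; it is checked for each choice of indices. -/
theorem conn_curvature (G H D : Fin 4 → ℝ) (hG : G 0 ≠ 0) (i j k l : Fin 4) :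
    (if k = 0 then connDeriv G H D i l j else 0) - (if l = 0 then connDeriv G H D i k j else 0)
      + ∑ m, (conn G H i k m * conn G H m l j - conn G H i l m * conn G H m k j)
    = sec G H D i j * G j * ((if i = k ∧ j = l then 1 else 0) - (if i = l ∧ j = k then 1 else 0)) := by
  fin_cases i <;> fin_cases j <;> fin_cases k <;> fin_cases l <;>
    simp [conn, connDeriv, sec, Fin.sum_univ_four] <;> field_simp <;> ring

/-- The Kronecker factor vanishes at `k = j`; the convention that `sec` is `0` on the diagonal
allows that term to stay in the sum. -/
theorem sum_sec_mul (G H D : Fin 4 → ℝ) (j l : Fin 4) :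
    ∑ k, sec G H D k j * G j * ((if k = k ∧ j = l then 1 else 0) - (if k = l ∧ j = k then 1 else 0))
      = if j = l then G j * ∑ k, sec G H D k j else 0 := by
  by_cases h : j = l
  · subst h
    have : ∀ k, sec G H D k j * G j
        * ((if k = k ∧ j = j then 1 else 0) - (if k = j ∧ j = k then 1 else 0))
        = sec G H D k j * G j := by
      intro k
      by_cases hk : k = j
      · simp [hk, sec]
      · simp [hk]
    rw [Finset.sum_congr rfl fun k _ => this k, if_pos rfl, ← Finset.sum_mul, mul_comm]
  · have : ∀ k, sec G H D k j * G j
        * ((if k = k ∧ j = l then 1 else 0) - (if k = l ∧ j = k then 1 else 0)) = 0 := by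
      intro k
      have : ¬ (k = l ∧ j = k) := fun hk => h (hk.2.trans hk.1)
      simp [h, this]
    rw [Finset.sum_congr rfl fun k _ => this k, if_neg h, Finset.sum_const_zero]

section Curvature

variable {I : Set ℝ} {V : Set (Fin 3 → ℝ)} {G : Fin 4 → ℝ → ℝ} {p : Pt}

theorem contDiffOn_rate (hI : IsOpen I) (hG : ∀ i, IsScaleFactor I (G i)) (i : Fin 4) :
    ContDiffOn ℝ ∞ (rate G i) I :=
  (contDiffOn_deriv hI (hG i).1).div (contDiffOn_const.mul (hG i).1)
    fun t ht => mul_ne_zero two_ne_zero ((hG i).2 t ht)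

theorem hasDerivAt_scale (hI : IsOpen I) (hG : ∀ i, IsScaleFactor I (G i)) (i : Fin 4) {t : ℝ}
    (ht : t ∈ I) : HasDerivAt (G i) (2 * rate G i t * G i t) t := by
  refine (hasDerivAt_of_smoothOn hI (hG i).1 ht).congr_deriv ?_
  have := (hG i).2 t ht
  simp only [rate]; field_simp

theorem hasDerivAt_rate (hI : IsOpen I) (hG : ∀ i, IsScaleFactor I (G i)) (i : Fin 4) {t : ℝ}
    (ht : t ∈ I) : HasDerivAt (rate G i) (deriv (rate G i) t) t :=
  hasDerivAt_of_smoothOn hI (contDiffOn_rate hI hG i) ht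

theorem diagMetric_apply (i j : Fin 4) (p : Pt) :
    diagMetric G p i j = if i = j then G i (p 0) else 0 := Matrix.diagonal_apply ..

theorem diagMetric_inv (hG : ∀ i, G i (p 0) ≠ 0) (i j : Fin 4) :
    (diagMetric G p)⁻¹ i j = if i = j then (G i (p 0))⁻¹ else 0 := by
  have : (diagMetric G p)⁻¹ = Matrix.diagonal fun i => (G i (p 0))⁻¹ := by
    refine Matrix.inv_eq_right_inv ?_
    rw [diagMetric, Matrix.diagonal_mul_diagonal, ← Matrix.diagonal_one]
    congr 1; funext i
    exact mul_inv_cancel₀ (hG i)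
  rw [this, Matrix.diagonal_apply]

theorem pd_diagMetric (hI : IsOpen I) (hG : ∀ i, IsScaleFactor I (G i)) (hp : p 0 ∈ I)
    (i j k : Fin 4) : pd k (fun q => diagMetric G q i j) p
      = if i = j ∧ k = 0 then 2 * rate G i (p 0) * G i (p 0) else 0 := by
  simp only [diagMetric_apply]
  by_cases hij : i = j
  · subst hij
    have h := hasDerivAt_scale hI hG i hp
    simp [pd_comp_coord k 0 h.differentiableAt, h.deriv]
  · simp [hij]

theorem christoffel_diagMetric (hI : IsOpen I) (hG : ∀ i, IsScaleFactor I (G i)) (hp : p 0 ∈ I)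
    (i j k : Fin 4) : christoffel (diagMetric G) i j k p
      = conn (fun i => G i (p 0)) (fun i => rate G i (p 0)) i j k := by
  have h0 : ∀ i, G i (p 0) ≠ 0 := fun i => (hG i).2 _ hp
  simp only [christoffel, diagMetric_inv h0, pd_diagMetric hI hG hp, ite_mul, zero_mul,
    Finset.sum_ite_eq, Finset.mem_univ, if_true, conn]
  have hi := h0 i
  have h00 := h0 0
  by_cases hj : j = 0 <;> by_cases hk : k = 0 <;> by_cases hi0 : i = 0 <;>
    by_cases hik : i = k <;> by_cases hij : i = j <;> by_cases hjk : j = k <;>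
    simp_all <;>
    first
      | (field_simp; done)
      | (field_simp; simp [h0])

theorem hasDerivAt_conn (hI : IsOpen I) (hG : ∀ i, IsScaleFactor I (G i)) {t : ℝ} (ht : t ∈ I)
    (i j k : Fin 4) :
    HasDerivAt (fun t => conn (fun i => G i t) (fun i => rate G i t) i j k)
      (connDeriv (fun i => G i t) (fun i => rate G i t) (fun i => deriv (rate G i) t) i j k) t := by
  simp only [conn, connDeriv]
  split_ifs
  · exact hasDerivAt_rate hI hG i ht
  · exact hasDerivAt_rate hI hG i ht
  · refine ((((hasDerivAt_rate hI hG j ht).mul (hasDerivAt_scale hI hG j ht)).div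
      (hasDerivAt_scale hI hG 0 ht) ((hG 0).2 t ht)).neg).congr_deriv ?_
    have := (hG 0).2 t ht
    simp only [Pi.mul_apply]
    field_simp
  · exact hasDerivAt_const ..

theorem riemannUp_diagMetric (hI : IsOpen I) (hG : ∀ i, IsScaleFactor I (G i)) (hp : p 0 ∈ I)
    (i j k l : Fin 4) : riemannUp (diagMetric G) i j k l p
      = sec (fun i => G i (p 0)) (fun i => rate G i (p 0)) (fun i => deriv (rate G i) (p 0)) i j
        * G j (p 0) * ((if i = k ∧ j = l then 1 else 0) - (if i = l ∧ j = k then 1 else 0)) := by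
  have hpd : ∀ a b c d, pd d (christoffel (diagMetric G) a b c) p
      = if d = 0 then connDeriv (fun i => G i (p 0)) (fun i => rate G i (p 0))
          (fun i => deriv (rate G i) (p 0)) a b c else 0 := by
    intro a b c d
    have hd := hasDerivAt_conn hI hG hp a b c
    have hO : IsOpen {q : Pt | q 0 ∈ I} := hI.preimage (continuous_apply 0)
    rw [pd_congr hO (fun q hq => christoffel_diagMetric hI hG hq a b c) hp,
      pd_comp_coord (h := fun t => conn (fun i => G i t) (fun i => rate G i t) a b c) d 0
      hd.differentiableAt, hd.deriv]
  rw [riemannUp, hpd, hpd]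
  simp only [christoffel_diagMetric hI hG hp]
  exact conn_curvature (fun i => G i (p 0)) _ _ ((hG 0).2 _ hp) i j k l

theorem ricci_diagMetric (hI : IsOpen I) (hG : ∀ i, IsScaleFactor I (G i)) (hp : p 0 ∈ I)
    (j l : Fin 4) : ricci (diagMetric G) j l p
      = if j = l then G j (p 0) * ∑ k, sec (fun i => G i (p 0)) (fun i => rate G i (p 0))
          (fun i => deriv (rate G i) (p 0)) k j else 0 := by
  rw [← sum_sec_mul (fun i => G i (p 0))]
  simp only [ricci, riemannUp_diagMetric hI hG hp]

theorem weyl_diagMetric (hI : IsOpen I) (hG : ∀ i, IsScaleFactor I (G i)) (hp : p 0 ∈ I)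
    (i j k l : Fin 4) : weyl (diagMetric G) i j k l p
      = G i (p 0) * G j (p 0) * ((if i = k ∧ j = l then 1 else 0) - (if i = l ∧ j = k then 1 else 0))
        * weylSec (fun i => G i (p 0)) (fun i => rate G i (p 0))
          (fun i => deriv (rate G i) (p 0)) i j := by
  have h0 : ∀ i, G i (p 0) ≠ 0 := fun i => (hG i).2 _ hp
  have hsc : scalarCurv (diagMetric G) p = ∑ l, ∑ k, sec (fun i => G i (p 0))
      (fun i => rate G i (p 0)) (fun i => deriv (rate G i) (p 0)) k l := by
    simp only [scalarCurv, diagMetric_inv h0, ricci_diagMetric hI hG hp, ite_mul, zero_mul,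
      Finset.sum_ite_eq, Finset.mem_univ, if_true]
    exact Finset.sum_congr rfl fun l _ => inv_mul_cancel_left₀ (h0 l) _
  rw [weyl, hsc]
  simp only [riemann, diagMetric_apply, ite_mul, zero_mul, Finset.sum_ite_eq, Finset.mem_univ,
    if_true, riemannUp_diagMetric hI hG hp, ricci_diagMetric hI hG hp, weylSec]
  by_cases hik : i = k <;> by_cases hjl : j = l <;> by_cases hil : i = l <;>
    by_cases hjk : j = k <;> simp_all <;> ring

/-- `weylDiff` is antisymmetric in its first two indices and its cyclic sum is zero, so any two
essentially different ones determine all. The tracefree `weylSec` is a linear combination of them.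
-/
theorem conformallyFlatOn_of_weylDiff (hI : IsOpen I) (hG : ∀ i, IsScaleFactor I (G i))
    {i j k : Fin 4} (hi : i ≠ 0) (hj : j ≠ 0) (hk : k ≠ 0) (hij : i ≠ j) (hik : i ≠ k)
    (hjk : j ≠ k) (h₁ : ∀ t ∈ I, weylDiff G i j k t = 0) (h₂ : ∀ t ∈ I, weylDiff G i k j t = 0) :
    ConformallyFlatOn (diagMetric G) (region I V) := by
  intro p hp a b c d
  have h0 := (hG 0).2 _ hp.1
  have e₁ : weylDiff G 1 2 3 (p 0) = 0 := by
    have h₁ := h₁ _ hp.1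
    have h₂ := h₂ _ hp.1
    fin_cases i <;> fin_cases j <;> fin_cases k <;> simp [weylDiff] at * <;>
    first
      | linear_combination h₁ | linear_combination -h₁ | linear_combination h₂
      | linear_combination -h₂ | linear_combination h₁ - h₂ | linear_combination h₂ - h₁
  have e₂ : weylDiff G 1 3 2 (p 0) = 0 := by
    have h₁ := h₁ _ hp.1
    have h₂ := h₂ _ hp.1
    fin_cases i <;> fin_cases j <;> fin_cases k <;> simp [weylDiff] at * <;>
    first
      | linear_combination h₁ | linear_combination -h₁ | linear_combination h₂
      | linear_combination -h₂ | linear_combination h₁ - h₂ | linear_combination h₂ - h₁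
  rw [weyl_diagMetric hI hG hp.1]
  by_cases hab : a = b
  · subst hab
    have : ((a = c ∧ a = d) ↔ (a = d ∧ a = c)) := and_comm
    simp [this]
  have : weylSec (fun i => G i (p 0)) (fun i => rate G i (p 0))
      (fun i => deriv (rate G i) (p 0)) a b = 0 := by
    clear h₁ h₂ hij hik hjk hi hj hk i j k
    simp only [weylDiff] at e₁ e₂
    fin_cases a <;> fin_cases b <;> simp [weylSec, sec, Fin.sum_univ_four] at * <;> field_simp <;>
    first
      | linear_combination 2 * e₁ + 2 * e₂ | linear_combination 2 * e₁ - 4 * e₂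
      | linear_combination 2 * e₂ - 4 * e₁ | linear_combination -2 * e₁ - 2 * e₂
      | linear_combination -2 * e₁ + 4 * e₂ | linear_combination -2 * e₂ + 4 * e₁
  rw [this, mul_zero]

/-- The three components `C_{0i0i}` suffice: their normalized differences are multiples of
`weylDiff`. -/
theorem weylDiff_eq_zero_of_conformallyFlatOn (hI : IsOpen I) (hG : ∀ i, IsScaleFactor I (G i))
    (hV : V.Nonempty) (h : ConformallyFlatOn (diagMetric G) (region I V)) {t : ℝ} (ht : t ∈ I) :
    weylDiff G 1 3 2 t = 0 ∧ weylDiff G 2 3 1 t = 0 := by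
  obtain ⟨x, hx⟩ := hV
  have hp : (Fin.cons t x : Pt) ∈ region I V := cons_mem_region ht hx
  have h0 : ∀ i, G i t ≠ 0 := fun i => (hG i).2 _ ht
  have key : ∀ i, i ≠ 0 → weylSec (fun i => G i t) (fun i => rate G i t)
      (fun i => deriv (rate G i) t) 0 i = 0 := by
    intro i hi
    have := h _ hp 0 i 0 i
    rw [weyl_diagMetric hI hG hp.1] at this
    simpa [h0, hi] using this
  have k1 := key 1 (by decide)
  have k2 := key 2 (by decide)
  have k3 := key 3 (by decide)
  have h00 := h0 0
  simp [weylSec, sec, Fin.sum_univ_four] at k1 k2 k3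
  field_simp at k1 k2 k3
  simp only [weylDiff]
  constructor
  · linear_combination (k3 - k1) / 6
  · linear_combination (k3 - k2) / 6

end Curvature

/-! ### The conformal Killing equations of a diagonal metric -/

section ConformalKilling

variable {I : Set ℝ} {V : Set (Fin 3 → ℝ)} {G : Fin 4 → ℝ → ℝ} {p : Pt}

theorem lieDeriv_diagMetric (hI : IsOpen I) (hG : ∀ i, IsScaleFactor I (G i)) (hp : p 0 ∈ I)
    (X : Pt → Pt) (a b : Fin 4) : lieDeriv X (diagMetric G) a b p
      = (if a = b then X p 0 * (2 * rate G a (p 0) * G a (p 0)) else 0)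
        + G b (p 0) * pd a (fun q => X q b) p + G a (p 0) * pd b (fun q => X q a) p := by
  simp only [lieDeriv, pd_diagMetric hI hG hp, Finset.sum_add_distrib]
  simp only [diagMetric_apply, ite_mul, mul_ite, zero_mul, mul_zero, Finset.sum_ite_eq,
    Finset.sum_ite_eq', Finset.mem_univ, if_true]
  congr 2
  by_cases hab : a = b <;> simp [hab]

theorem isCKV_diagMetric_iff (hI : IsOpen I) (hG : ∀ i, IsScaleFactor I (G i))
    (X : Pt → Pt) (ψ : Pt → ℝ) : IsCKV (diagMetric G) (region I V) X ψ ↔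
      (∀ i, ContDiffOn ℝ ∞ (fun q => X q i) (region I V)) ∧
      ∀ p ∈ region I V,
        (∀ i, X p 0 * rate G i (p 0) + pd i (fun q => X q i) p = ψ p) ∧
        ∀ i j, i ≠ j → G i (p 0) * pd j (fun q => X q i) p
          + G j (p 0) * pd i (fun q => X q j) p = 0 := by
  rw [IsCKV, contDiffOn_pi]
  refine and_congr Iff.rfl (forall₂_congr fun p hp => ?_)
  have h0 : ∀ i, G i (p 0) ≠ 0 := fun i => (hG i).2 _ hp.1
  simp only [lieDeriv_diagMetric hI hG hp.1, diagMetric_apply]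
  constructor
  · intro h
    refine ⟨fun i => ?_, fun i j hij => ?_⟩
    · have := h i i
      simp only [if_true] at this
      refine mul_left_cancel₀ (mul_ne_zero two_ne_zero (h0 i)) ?_
      linear_combination this
    · have := h i j
      simp only [hij, if_false] at this
      linear_combination this
  · rintro ⟨h₁, h₂⟩ a b
    by_cases hab : a = b
    · subst hab
      simp only [if_true]
      linear_combination 2 * G a (p 0) * h₁ a
    · simp only [hab, if_false]
      linear_combination h₂ a b hab

/-- All coefficients in the conformal Killing equations depend on time alone, so differentiating an
equation produces an extra term only in the time direction. -/
theorem pd_combination {U : Set Pt} (hU : IsOpen U) (hp : p ∈ U) {a b : ℝ → ℝ} {a' b' : ℝ}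
    {u v w : Pt → ℝ} (ha : HasDerivAt a a' (p 0)) (hb : HasDerivAt b b' (p 0))
    (hu : ContDiffOn ℝ ∞ u U) (hv : ContDiffOn ℝ ∞ v U)
    (h : ∀ q ∈ U, a (q 0) * u q + b (q 0) * v q = w q) (i : Fin 4) :
    (if i = 0 then a' * u p + b' * v p else 0) + a (p 0) * pd i u p + b (p 0) * pd i v p
      = pd i w p := by
  have hu := differentiableAt_of_smoothOn hU hu hp
  have hv := differentiableAt_of_smoothOn hU hv hp
  have ha' : DifferentiableAt ℝ (fun q : Pt => a (q 0)) p :=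
    (ha.comp_hasFDerivAt p (hasFDerivAt_coord 0 p)).differentiableAt
  have hb' : DifferentiableAt ℝ (fun q : Pt => b (q 0)) p :=
    (hb.comp_hasFDerivAt p (hasFDerivAt_coord 0 p)).differentiableAt
  rw [← pd_congr hU h hp i, pd_add (f := fun q => a (q 0) * u q) (g := fun q => b (q 0) * v q)
    (ha'.mul hu) (hb'.mul hv),
    pd_mul ha' hu, pd_mul hb' hv,
    pd_comp_coord i 0 ha.differentiableAt, pd_comp_coord i 0 hb.differentiableAt, ha.deriv, hb.deriv]
  by_cases hi : i = 0
  · simp only [hi, if_true]; ring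
  · simp only [hi, if_false]; ring

theorem pd_time_mul {U : Set Pt} (hU : IsOpen U) (hp : p ∈ U) {a : ℝ → ℝ} {a' : ℝ}
    {u w : Pt → ℝ} (ha : HasDerivAt a a' (p 0)) (hu : ContDiffOn ℝ ∞ u U)
    (h : ∀ q ∈ U, w q = a (q 0) * u q) (i : Fin 4) :
    pd i w p = (if i = 0 then a' * u p else 0) + a (p 0) * pd i u p := by
  have := pd_combination (b := fun _ => 0) (w := w) hU hp ha (hasDerivAt_const _ _) hu hu
    (fun q hq => by rw [h q hq, zero_mul, add_zero]) i
  simpa using this.symm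

/-- The conformal Killing equations for `diagMetric G`, with the conformal factor eliminated. -/
structure CKVSystem (I : Set ℝ) (V : Set (Fin 3 → ℝ)) (G : Fin 4 → ℝ → ℝ)
    (x : Fin 4 → Pt → ℝ) : Prop where
  openTime : IsOpen I
  openSpace : IsOpen V
  scale : ∀ i, IsScaleFactor I (G i)
  smooth : ∀ i, ContDiffOn ℝ ∞ (x i) (region I V)
  diag : ∀ p ∈ region I V, ∀ i,
    (rate G i (p 0) - rate G 0 (p 0)) * x 0 p + pd i (x i) p = pd 0 (x 0) p
  off : ∀ p ∈ region I V, ∀ i j, i ≠ j →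
    G i (p 0) * pd j (x i) p + G j (p 0) * pd i (x j) p = 0

/-! ### Integrability conditions of the conformal Killing equations. -/

namespace CKVSystem

variable {x : Fin 4 → Pt → ℝ} {i j k : Fin 4}

theorem isOpen (h : CKVSystem I V G x) : IsOpen (region I V) :=
  isOpen_region h.openTime h.openSpace

theorem smooth_pd (h : CKVSystem I V G x) (i j : Fin 4) :
    ContDiffOn ℝ ∞ (pd i (x j)) (region I V) :=
  contDiffOn_pd h.isOpen (h.smooth j) i

theorem comm (h : CKVSystem I V G x) (hp : p ∈ region I V) (a b i : Fin 4) :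
    pd a (pd b (x i)) p = pd b (pd a (x i)) p :=
  pd_comm h.isOpen (h.smooth i) hp a b

theorem comm_left (h : CKVSystem I V G x) (hp : p ∈ region I V) (a b c i : Fin 4) :
    pd a (pd b (pd c (x i))) p = pd b (pd a (pd c (x i))) p :=
  pd_comm h.isOpen (h.smooth_pd c i) hp a b

theorem comm_right (h : CKVSystem I V G x) (hp : p ∈ region I V) (a b c i : Fin 4) :
    pd a (pd b (pd c (x i))) p = pd a (pd c (pd b (x i))) p :=
  pd_congr h.isOpen (fun _ hq => h.comm hq b c i) hp a

theorem scale_deriv (h : CKVSystem I V G x) (hp : p ∈ region I V) (i : Fin 4) :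
    HasDerivAt (G i) (2 * rate G i (p 0) * G i (p 0)) (p 0) :=
  hasDerivAt_scale h.openTime h.scale i hp.1

theorem rate_sub_deriv (h : CKVSystem I V G x) (hp : p ∈ region I V) (i j : Fin 4) :
    HasDerivAt (fun t => rate G i t - rate G j t)
      (deriv (rate G i) (p 0) - deriv (rate G j) (p 0)) (p 0) :=
  (hasDerivAt_rate h.openTime h.scale i hp.1).sub (hasDerivAt_rate h.openTime h.scale j hp.1)

theorem scale_ne (h : CKVSystem I V G x) (hp : p ∈ region I V) (i : Fin 4) : G i (p 0) ≠ 0 :=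
  (h.scale i).2 _ hp.1

theorem pd_off (h : CKVSystem I V G x) (hp : p ∈ region I V) (hij : i ≠ j) (k : Fin 4) :
    (if k = 0 then 2 * rate G i (p 0) * G i (p 0) * pd j (x i) p
        + 2 * rate G j (p 0) * G j (p 0) * pd i (x j) p else 0)
      + G i (p 0) * pd k (pd j (x i)) p + G j (p 0) * pd k (pd i (x j)) p = 0 := by
  have := pd_combination (w := fun _ => 0) h.isOpen hp (h.scale_deriv hp i) (h.scale_deriv hp j)
    (h.smooth_pd j i) (h.smooth_pd i j) (fun q hq => h.off q hq i j hij) k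
  simpa using this

theorem pd_off' (h : CKVSystem I V G x) (hp : p ∈ region I V) (hij : i ≠ j) (hk : k ≠ 0) :
    G i (p 0) * pd k (pd j (x i)) p + G j (p 0) * pd k (pd i (x j)) p = 0 := by
  simpa [hk] using h.pd_off hp hij k

/-- The off-diagonal equations for the pairs `(i, 0)`, `(j, 0)`, `(i, j)`, differentiated in the
missing direction, are three linear relations among `∂_0 ∂_j x_i`, `∂_0 ∂_i x_j` and `∂_i ∂_j x_0`.
The first conclusion makes the shear vanish everywhere or nowhere on a time line. -/
theorem time_shear (h : CKVSystem I V G x) (hp : p ∈ region I V) (hi : i ≠ 0) (hj : j ≠ 0)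
    (hij : i ≠ j) :
    pd 0 (pd j (x i)) p = (rate G j (p 0) - rate G i (p 0)) * pd j (x i) p ∧
    G 0 (p 0) * pd i (pd j (x 0)) p
      = (rate G i (p 0) - rate G j (p 0)) * G i (p 0) * pd j (x i) p := by
  have e₁ := h.pd_off' hp hi hj
  have e₂ := h.pd_off' hp hj hi
  have e₃ := h.pd_off hp hij 0
  have e₄ := h.off p hp i j hij
  rw [h.comm hp j 0 i, h.comm hp j i 0] at e₁
  rw [h.comm hp i 0 j] at e₂
  simp only [if_true] at e₃
  have key : G 0 (p 0) * pd i (pd j (x 0)) p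
      = (rate G i (p 0) - rate G j (p 0)) * G i (p 0) * pd j (x i) p := by
    linear_combination (e₁ + e₂ - e₃) / 2 + rate G j (p 0) * e₄
  refine ⟨mul_left_cancel₀ (h.scale_ne hp i) ?_, key⟩
  linear_combination e₁ - key

/-- `G_i ∂_k ∂_j x_i` is symmetric in `j, k` and changes sign when `i` is exchanged with another
index, hence is zero: the argument that makes the Levi-Civita connection unique. -/
theorem mixed_shear (h : CKVSystem I V G x) (hp : p ∈ region I V) (hi : i ≠ 0) (hj : j ≠ 0)
    (hk : k ≠ 0) (hij : i ≠ j) (hik : i ≠ k) (hjk : j ≠ k) : pd k (pd j (x i)) p = 0 := by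
  have e₁ := h.pd_off' hp hij hk
  have e₂ := h.pd_off' hp hjk hi
  have e₃ := h.pd_off' hp hik.symm hj
  rw [h.comm hp k i j] at e₁
  rw [h.comm hp i j k] at e₂
  rw [h.comm hp j k i] at e₃
  have : G i (p 0) * pd k (pd j (x i)) p = 0 := by linear_combination (e₁ - e₂ + e₃) / 2
  exact (mul_eq_zero.mp this).resolve_left (h.scale_ne hp i)

theorem pd_diag (h : CKVSystem I V G x) (hp : p ∈ region I V) (hj : j ≠ 0) (k : Fin 4) :
    (rate G k (p 0) - rate G 0 (p 0)) * pd j (x 0) p + pd j (pd k (x k)) p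
      = pd j (pd 0 (x 0)) p := by
  have := pd_combination (b := fun _ => 1) (w := pd 0 (x 0)) h.isOpen hp
    (h.rate_sub_deriv hp k 0) (hasDerivAt_const _ _) (h.smooth 0) (h.smooth_pd k k)
    (fun q hq => by rw [one_mul]; exact h.diag q hq k) j
  simpa [hj] using this

theorem pd_pd_diag (h : CKVSystem I V G x) (hp : p ∈ region I V) (hi : i ≠ 0) (hj : j ≠ 0)
    (k : Fin 4) :
    (rate G k (p 0) - rate G 0 (p 0)) * pd i (pd j (x 0)) p + pd i (pd j (pd k (x k))) p
      = pd 0 (pd i (pd j (x 0))) p := by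
  have := pd_combination (b := fun _ => 1) (w := pd j (pd 0 (x 0))) h.isOpen hp
    (h.rate_sub_deriv hp k 0) (hasDerivAt_const _ _) (h.smooth_pd j 0)
    (contDiffOn_pd h.isOpen (h.smooth_pd k k) j)
    (fun q hq => by rw [one_mul]; exact h.pd_diag hq hj k) i
  rw [h.comm_right hp i j 0 0, h.comm_left hp i 0 j 0] at this
  simpa [hi] using this

/-- In the diagonal equation of the third axis `k`, differentiated in `i` and `j`, the term `∂_i ∂_j
∂_k x_k` drops out by `mixed_shear`. -/
theorem time_hessian (h : CKVSystem I V G x) (hp : p ∈ region I V) (hi : i ≠ 0) (hj : j ≠ 0)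
    (hk : k ≠ 0) (hij : i ≠ j) (hik : i ≠ k) (hjk : j ≠ k) :
    pd 0 (pd i (pd j (x 0))) p
      = (rate G k (p 0) - rate G 0 (p 0)) * pd i (pd j (x 0)) p := by
  have h₁ := h.pd_pd_diag hp hi hj k
  have h₂ : pd i (pd j (pd k (x k))) p = 0 := by
    rw [h.comm_right hp i j k k, h.comm_left hp i k j k,
      pd_congr h.isOpen (g := fun _ => 0)
        (fun q hq => h.mixed_shear hq hk hj hi hjk.symm hik.symm hij.symm) hp k, pd_const]
  rw [← h₁, h₂, add_zero]

/-- The twice differentiated diagonal equations of the axes `i` and `k` have the same right-hand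
side; they are subtracted. -/
theorem hessian_shear (h : CKVSystem I V G x) (hp : p ∈ region I V) (hi : i ≠ 0) (hj : j ≠ 0)
    (hk : k ≠ 0) (hij : i ≠ j) (hik : i ≠ k) (hjk : j ≠ k) :
    pd i (pd i (pd j (x i))) p
      = (rate G k (p 0) - rate G i (p 0)) * pd i (pd j (x 0)) p := by
  have h₁ := h.pd_pd_diag hp hi hj i
  rw [h.time_hessian hp hi hj hk hij hik hjk, h.comm_right hp i j i i] at h₁
  linear_combination h₁

/-- The evolution equation of the shear has a coefficient depending on time only, so spatial
derivatives of the shear obey it too. -/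
theorem time_hessian_shear (h : CKVSystem I V G x) (hp : p ∈ region I V) (hi : i ≠ 0)
    (hj : j ≠ 0) (hij : i ≠ j) :
    pd 0 (pd i (pd i (pd j (x i)))) p
      = (rate G j (p 0) - rate G i (p 0)) * pd i (pd i (pd j (x i))) p := by
  have step : ∀ q ∈ region I V, pd 0 (pd i (pd j (x i))) q
      = (rate G j (q 0) - rate G i (q 0)) * pd i (pd j (x i)) q := by
    intro q hq
    have := pd_time_mul h.isOpen hq (h.rate_sub_deriv hq j i) (h.smooth_pd j i)
      (fun r hr => (h.time_shear hr hi hj hij).1) i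
    rw [h.comm_left hq i 0 j i] at this
    simpa [hi] using this
  have := pd_time_mul h.isOpen hp (h.rate_sub_deriv hp j i)
    (contDiffOn_pd h.isOpen (h.smooth_pd j i) i) step i
  rw [pd_comm h.isOpen (contDiffOn_pd h.isOpen (h.smooth_pd j i) i) hp i 0] at this
  simpa [hi] using this

/-- The time derivative of `hessian_shear` is known in two ways, from `time_hessian_shear` and from
`time_hessian`; the mismatch is a `weylDiff`. -/
theorem weylDiff_mul_hessian (h : CKVSystem I V G x) (hp : p ∈ region I V) (hi : i ≠ 0)
    (hj : j ≠ 0) (hk : k ≠ 0) (hij : i ≠ j) (hik : i ≠ k) (hjk : j ≠ k) :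
    weylDiff G k i j (p 0) * pd i (pd j (x 0)) p = 0 := by
  have := pd_time_mul h.isOpen hp (h.rate_sub_deriv hp k i)
    (contDiffOn_pd h.isOpen (h.smooth_pd j 0) i)
    (fun r hr => h.hessian_shear hr hi hj hk hij hik hjk) 0
  rw [h.time_hessian_shear hp hi hj hij, h.hessian_shear hp hi hj hk hij hik hjk,
    h.time_hessian hp hi hj hk hij hik hjk] at this
  simp only [if_true] at this
  rw [weylDiff]
  linear_combination -this

/-- Compatibility of the relation between `∂_i ∂_j x_0` and the shear in `time_shear` with the
evolution equations of both sides. -/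
theorem weylDiff_mul_shear (h : CKVSystem I V G x) (hp : p ∈ region I V) (hi : i ≠ 0)
    (hj : j ≠ 0) (hk : k ≠ 0) (hij : i ≠ j) (hik : i ≠ k) (hjk : j ≠ k) :
    weylDiff G i j k (p 0) * pd j (x i) p = 0 := by
  have e := (h.time_shear hp hi hj hij).2
  have := pd_combination (w := fun _ => 0) (b := fun t => - ((rate G i t - rate G j t) * G i t))
    h.isOpen hp (h.scale_deriv hp 0)
    ((h.rate_sub_deriv hp i j).mul (h.scale_deriv hp i)).neg
    (contDiffOn_pd h.isOpen (h.smooth_pd j 0) i) (h.smooth_pd j i)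
    (fun r hr => by
      have := (h.time_shear hr hi hj hij).2
      linear_combination this) 0
  rw [(h.time_shear hp hi hj hij).1, h.time_hessian hp hi hj hk hij hik hjk, pd_const] at this
  simp only [if_true] at this
  refine (mul_eq_zero.mp (?_ : G i (p 0) * (weylDiff G i j k (p 0) * pd j (x i) p) = 0)).resolve_left
    (h.scale_ne hp i)
  rw [weylDiff]
  linear_combination -this + (rate G 0 (p 0) + rate G k (p 0)) * e

end CKVSystem

end ConformalKilling

/-! ### Rigidity: conformal Killing vectors act diagonally -/

section Rigidity

variable {I : Set ℝ} {V : Set (Fin 3 → ℝ)} {G : Fin 4 → ℝ → ℝ} {p : Pt}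

/-- Equal rates throughout `I` would make `G i / G j` constant. Only one time with distinct rates is
obtained; linear equations propagate what is learnt there. -/
theorem exists_rate_ne (hI : IsOpenInterval I) (hG : ∀ i, IsScaleFactor I (G i))
    (hLRS : ¬ IsLRSOn (diagMetric G) (region I V)) {i j : Fin 4} (hi : i ≠ 0) (hj : j ≠ 0)
    (hij : i ≠ j) : ∃ t ∈ I, rate G i t - rate G j t ≠ 0 := by
  by_contra! hcon
  obtain ⟨c, hc⟩ := eqOn_const_of_hasDerivAt (y := fun t => G i t / G j t) hI fun t ht => by
    have hj0 := (hG j).2 t ht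
    refine ((hasDerivAt_scale hI.1 hG i ht).div (hasDerivAt_scale hI.1 hG j ht) hj0).congr_deriv ?_
    rw [sub_eq_zero.mp (hcon t ht)]
    field_simp
    ring
  refine hLRS ⟨i.pred hi, j.pred hj, fun h => hij (Fin.pred_inj.mp h), c, fun p hp => ?_⟩
  have hj0 := (hG j).2 _ hp.1
  have := hc _ hp.1
  simp only [Fin.succ_pred, diagMetric_apply, if_true]
  field_simp at this
  linear_combination this

theorem continuousOn_rate_sub (hI : IsOpen I) (hG : ∀ i, IsScaleFactor I (G i)) (i j : Fin 4) :
    ContinuousOn (fun t => rate G i t - rate G j t) I :=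
  (contDiffOn_rate hI hG i).continuousOn.sub (contDiffOn_rate hI hG j).continuousOn

theorem exists_third_axis : ∀ i j : Fin 4, i ≠ 0 → j ≠ 0 → i ≠ j →
    ∃ k : Fin 4, k ≠ 0 ∧ i ≠ k ∧ j ≠ k := by decide

namespace CKVSystem

variable {x : Fin 4 → Pt → ℝ} {i j k : Fin 4}

/-- A nonzero shear at one point persists along its time line and kills one `weylDiff`. As the
metric is not LRS, the mixed second derivative of `x 0` is then nonzero as well and kills a second
one, which gives conformal flatness. -/
theorem shear_eq_zero (h : CKVSystem I V G x) (hI : IsOpenInterval I)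
    (hLRS : ¬ IsLRSOn (diagMetric G) (region I V))
    (hCF : ¬ ConformallyFlatOn (diagMetric G) (region I V)) (hi : i ≠ 0) (hj : j ≠ 0)
    (hij : i ≠ j) (hp : p ∈ region I V) : pd j (x i) p = 0 := by
  obtain ⟨k, hk, hik, hjk⟩ := exists_third_axis i j hi hj hij
  by_contra hne
  have hne' : ∀ t ∈ I, pd j (x i) (Function.update p 0 t) ≠ 0 := fun t ht h0 =>
    hne (eq_zero_of_linear_pd hI h.openSpace (h.smooth_pd j i)
      (continuousOn_rate_sub hI.1 h.scale j i) (fun q hq => (h.time_shear hq hi hj hij).1) hp ht h0)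
  have hW : ∀ t ∈ I, weylDiff G i j k t = 0 := by
    intro t ht
    have := h.weylDiff_mul_shear (update_mem_region hp ht) hi hj hk hij hik hjk
    simpa using (mul_eq_zero.mp this).resolve_right (hne' t ht)
  -- Vanishing of `weylDiff G i j k` is a linear homogeneous equation for `H_i - H_j`, so a single
  -- zero would contradict `exists_rate_ne`.
  have hrate : ∀ t ∈ I, rate G i t - rate G j t ≠ 0 := by
    obtain ⟨s, hs, hs0⟩ := exists_rate_ne hI h.scale hLRS hi hj hij
    intro t ht h0
    refine hs0 (eq_zero_of_linear_ode (y := fun t => rate G i t - rate G j t)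
      (h := fun t => (rate G k t - rate G i t) - (rate G j t - rate G 0 t)) hI
      ((continuousOn_rate_sub hI.1 h.scale k i).sub (continuousOn_rate_sub hI.1 h.scale j 0))
      (fun u hu => ?_) ht h0 s hs)
    refine ((hasDerivAt_rate hI.1 h.scale i hu).sub
      (hasDerivAt_rate hI.1 h.scale j hu)).congr_deriv ?_
    have := hW u hu
    rw [weylDiff] at this
    linear_combination this
  refine hCF (conformallyFlatOn_of_weylDiff hI.1 h.scale hi hj hk hij hik hjk hW fun t ht => ?_)
  have hq := update_mem_region hp ht
  have e₁ := h.weylDiff_mul_hessian hq hi hj hk hij hik hjk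
  have e₂ := (h.time_shear hq hi hj hij).2
  simp only [Function.update_self] at e₁ e₂
  have e₃ : weylDiff G k i j t = 0 := by
    refine (mul_eq_zero.mp e₁).resolve_right fun h0 => ?_
    rw [h0, mul_zero] at e₂
    exact mul_ne_zero (mul_ne_zero (hrate t ht) ((h.scale i).2 t ht)) (hne' t ht) e₂.symm
  rw [weylDiff] at e₃ ⊢
  linear_combination -e₃

/-- Both axes other than `j` give an evolution equation for `∂_j x_0`, with different coefficients
at some time. There the gradient is zero, and it stays zero. -/
theorem gradient_eq_zero (h : CKVSystem I V G x) (hI : IsOpenInterval I)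
    (hLRS : ¬ IsLRSOn (diagMetric G) (region I V))
    (hCF : ¬ ConformallyFlatOn (diagMetric G) (region I V)) (hj : j ≠ 0)
    (hp : p ∈ region I V) : pd j (x 0) p = 0 := by
  obtain ⟨i, k, hi, hk, hij, hkj, hik⟩ : ∃ i k : Fin 4, i ≠ 0 ∧ k ≠ 0 ∧ i ≠ j ∧ k ≠ j ∧ i ≠ k := by
    revert j; decide
  have hode : ∀ i, i ≠ 0 → i ≠ j → ∀ q ∈ region I V,
      pd 0 (pd j (x 0)) q = (rate G i (q 0) - rate G 0 (q 0)) * pd j (x 0) q := by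
    intro i hi hij q hq
    have := h.pd_diag hq hj i
    rw [h.comm hq j i i, pd_congr h.isOpen (g := fun _ => 0)
      (fun r hr => h.shear_eq_zero hI hLRS hCF hi hj hij hr) hq i, pd_const,
      h.comm hq j 0 0] at this
    linear_combination -this
  obtain ⟨s, hs, hs0⟩ := exists_rate_ne hI h.scale hLRS hi hk hik
  refine eq_zero_of_linear_pd hI h.openSpace (h.smooth_pd j 0)
    (continuousOn_rate_sub hI.1 h.scale i 0) (hode i hi hij) hp hs ?_
  have hq := update_mem_region hp hs
  have e₁ := hode i hi hij _ hq
  have e₂ := hode k hk hkj _ hq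
  simp only [Function.update_self] at e₁ e₂
  refine (mul_eq_zero.mp ?_).resolve_left hs0
  linear_combination e₂ - e₁

/-- With shear and gradient gone, `x i` depends on its own coordinate only, and `∂_i x_i` has no
derivative in any direction. -/
theorem exists_affine (h : CKVSystem I V G x) (hI : IsOpenInterval I) (hV : IsPreconnected V)
    (hLRS : ¬ IsLRSOn (diagMetric G) (region I V))
    (hCF : ¬ ConformallyFlatOn (diagMetric G) (region I V)) (hi : i ≠ 0) :
    ∃ α κ : ℝ, ∀ p ∈ region I V, pd i (x i) p = α ∧ x i p = α * p i + κ := by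
  have hU := isPreconnected_region hI.isPreconnected hV
  have h0 : ∀ p ∈ region I V, ∀ j, j ≠ i → pd j (x i) p = 0 := by
    intro p hp j hji
    by_cases hj : j = 0
    · subst hj
      have := h.off p hp i 0 hi
      rw [h.gradient_eq_zero hI hLRS hCF hi hp, mul_zero, add_zero] at this
      exact (mul_eq_zero.mp this).resolve_left (h.scale_ne hp i)
    · exact h.shear_eq_zero hI hLRS hCF hi hj hji.symm hp
  obtain ⟨α, hα⟩ := exists_eq_const_of_pd h.isOpen hU (h.smooth_pd i i) (by
    intro p hp j
    by_cases hj : j = i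
    · subst hj
      have := h.pd_diag hp hi j
      rw [h.gradient_eq_zero hI hLRS hCF hi hp, h.comm hp j 0 0,
        pd_congr h.isOpen (g := fun _ => 0)
        (fun r hr => h.gradient_eq_zero hI hLRS hCF hi hr) hp 0, pd_const] at this
      linear_combination this
    · rw [h.comm hp j i i, pd_congr h.isOpen (g := fun _ => 0) (fun r hr => h0 r hr j hj) hp i,
        pd_const])
  have hsm : ContDiffOn ℝ ∞ (fun p : Pt => α * p i) (region I V) :=
    (contDiff_const.mul (contDiff_apply ℝ ℝ i)).contDiffOn
  obtain ⟨κ, hκ⟩ := exists_eq_const_of_pd h.isOpen hU ((h.smooth i).sub hsm) (by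
    intro p hp j
    have e := pd_sub (differentiableAt_of_smoothOn h.isOpen (h.smooth i) hp)
      (differentiableAt_of_smoothOn h.isOpen hsm hp) j
    have e' := pd_comp_coord (h := fun s => α * s) (p := p) j i (by fun_prop)
    have e'' : deriv (fun s => α * s) (p i) = α := by simp
    change pd j (fun q => x i q - α * q i) p = 0
    rw [e, e', e'']
    by_cases hj : j = i
    · subst hj; simp [hα p hp]
    · simp [hj, h0 p hp j hj])
  refine ⟨α, κ, fun p hp => ⟨hα p hp, ?_⟩⟩
  linear_combination hκ p hp

end CKVSystem

/-- The field `F(t) ∂_t + (αᵢ xᵢ + κᵢ) ∂_i`, satisfying the conformal Killing equations of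
`diagMetric G` with conformal factor `ψ`. -/
structure DiagonalCKV (I : Set ℝ) (V : Set (Fin 3 → ℝ)) (G : Fin 4 → ℝ → ℝ) (X : Pt → Pt)
    (ψ : Pt → ℝ) (F : ℝ → ℝ) (α κ : Fin 4 → ℝ) : Prop where
  smooth : ContDiffOn ℝ ∞ F I
  time : ∀ p ∈ region I V, X p 0 = F (p 0)
  space : ∀ p ∈ region I V, ∀ i, i ≠ 0 → X p i = α i * p i + κ i
  eq : ∀ t ∈ I, ∀ i, i ≠ 0 → deriv F t = (rate G i t - rate G 0 t) * F t + α i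
  factor : ∀ p ∈ region I V, ψ p = deriv F (p 0) + rate G 0 (p 0) * F (p 0)

theorem DiagonalCKV.isCKV {X : Pt → Pt} {ψ : Pt → ℝ} {F : ℝ → ℝ} {α κ : Fin 4 → ℝ}
    (hI : IsOpen I) (hV : IsOpen V) (hG : ∀ i, IsScaleFactor I (G i))
    (h : DiagonalCKV I V G X ψ F α κ) : IsCKV (diagMetric G) (region I V) X ψ := by
  have hU := isOpen_region hI hV
  have hd : ∀ p ∈ region I V, ∀ j, pd j (fun q => X q 0) p = if j = 0 then deriv F (p 0) else 0 :=
    fun p hp j => by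
      rw [pd_congr hU h.time hp,
        pd_comp_coord j 0 (hasDerivAt_of_smoothOn hI h.smooth hp.1).differentiableAt]
  have hs : ∀ p ∈ region I V, ∀ i, i ≠ 0 → ∀ j, pd j (fun q => X q i) p
      = if j = i then α i else 0 := fun p hp i hi j => by
    rw [pd_congr hU (fun q hq => h.space q hq i hi) hp,
      pd_comp_coord (h := fun s => α i * s + κ i) j i (by fun_prop)]
    simp
  refine (isCKV_diagMetric_iff hI hG X ψ).2 ⟨fun i => ?_, fun p hp => ⟨fun i => ?_, ?_⟩⟩
  · by_cases hi : i = 0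
    · subst hi
      refine (h.smooth.comp (contDiff_apply ℝ ℝ (0 : Fin 4)).contDiffOn
        (fun p hp => hp.1)).congr h.time
    · refine ContDiffOn.congr (f := fun p : Pt => α i * p i + κ i) ?_
        fun p hp => h.space p hp i hi
      exact ((contDiff_const.mul (contDiff_apply ℝ ℝ i)).add contDiff_const).contDiffOn
  · rw [h.factor p hp, h.time p hp]
    by_cases hi : i = 0
    · subst hi
      rw [hd p hp, if_pos rfl]; ring
    · rw [hs p hp i hi, if_pos rfl, h.eq _ hp.1 i hi]; ring
  · intro i j hij
    have : ∀ i j, i ≠ j → pd j (fun q => X q i) p = 0 := by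
      intro i j hij
      by_cases hi : i = 0
      · subst hi
        rw [hd p hp, if_neg hij.symm]
      · rw [hs p hp i hi, if_neg hij.symm]
    rw [this i j hij, this j i hij.symm, mul_zero, mul_zero, add_zero]

/-- The function `F` is read off along one time line, through the base point `q₀`. -/
theorem IsCKV.exists_diagonalCKV {X : Pt → Pt} {ψ : Pt → ℝ} (hI : IsOpenInterval I)
    (hV : IsOpen V) (hVc : IsConnected V) (hG : ∀ i, IsScaleFactor I (G i))
    (hLRS : ¬ IsLRSOn (diagMetric G) (region I V))
    (hCF : ¬ ConformallyFlatOn (diagMetric G) (region I V))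
    (hX : IsCKV (diagMetric G) (region I V) X ψ) :
    ∃ F α κ, DiagonalCKV I V G X ψ F α κ := by
  obtain ⟨hsm, heq⟩ := (isCKV_diagMetric_iff hI.1 hG X ψ).1 hX
  have h : CKVSystem I V G (fun i q => X q i) :=
    ⟨hI.1, hV, hG, hsm, fun p hp i => by
      linear_combination (heq p hp).1 i - (heq p hp).1 0, fun p hp => (heq p hp).2⟩
  choose α κ hακ using fun i : {i : Fin 4 // i ≠ 0} =>
    h.exists_affine hI hVc.isPreconnected hLRS hCF i.2
  obtain ⟨t₀, ht₀⟩ := hI.2.2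
  obtain ⟨x₀, hx₀⟩ := hVc.nonempty
  set q₀ : Pt := Fin.cons t₀ x₀ with hq₀
  have hq₀U : q₀ ∈ region I V := cons_mem_region ht₀ hx₀
  have hline : ∀ p ∈ region I V, ∀ t ∈ I, HasDerivAt (fun s => X (Function.update p 0 s) 0)
      (pd 0 (fun q => X q 0) (Function.update p 0 t)) t := fun p hp t ht =>
    hasDerivAt_timeLine (differentiableAt_of_smoothOn h.isOpen (hsm 0) (update_mem_region hp ht))
  have hode : ∀ p ∈ region I V, ∀ t ∈ I, ∀ i (hi : i ≠ 0),
      pd 0 (fun q => X q 0) (Function.update p 0 t)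
        = (rate G i t - rate G 0 t) * X (Function.update p 0 t) 0 + α ⟨i, hi⟩ := by
    intro p hp t ht i hi
    have hq := update_mem_region hp ht
    have := h.diag _ hq i
    rw [(hακ ⟨i, hi⟩ _ hq).1, Function.update_self] at this
    exact this.symm
  -- The time components along two time lines satisfy the same inhomogeneous equations, so their
  -- difference satisfies the homogeneous ones for axes `1` and `2`. It is zero where these two
  -- rates differ, hence always.
  have hF : ∀ p ∈ region I V, X p 0 = X (Function.update q₀ 0 (p 0)) 0 := by
    intro p hp
    obtain ⟨s, hs, hs0⟩ := exists_rate_ne hI hG hLRS (i := 1) (j := 2) (by decide) (by decide)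
      (by decide)
    have := eq_zero_of_linear_ode
      (y := fun t => X (Function.update p 0 t) 0 - X (Function.update q₀ 0 t) 0)
      hI (continuousOn_rate_sub hI.1 hG 1 0)
      (fun t ht => ((hline p hp t ht).sub (hline q₀ hq₀U t ht)).congr_deriv (by
        rw [hode p hp t ht 1 (by decide), hode q₀ hq₀U t ht 1 (by decide)]; ring)) hs
      (by
        refine (mul_eq_zero.mp ?_).resolve_left hs0
        linear_combination hode p hp s hs 2 (by decide) - hode p hp s hs 1 (by decide)
          - hode q₀ hq₀U s hs 2 (by decide) + hode q₀ hq₀U s hs 1 (by decide)) (p 0) hp.1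
    simp only [Function.update_eq_self] at this
    linear_combination this
  have hupd : ContDiff ℝ ∞ fun t : ℝ => Function.update q₀ 0 t := contDiff_update _ q₀ 0
  refine ⟨fun t => X (Function.update q₀ 0 t) 0, fun i => if hi : i = 0 then 0 else α ⟨i, hi⟩,
    fun i => if hi : i = 0 then 0 else κ ⟨i, hi⟩, ?_, hF, ?_, ?_, ?_⟩
  · exact (hsm 0).comp hupd.contDiffOn fun t ht => update_mem_region hq₀U ht
  · intro p hp i hi
    simpa [hi] using (hακ ⟨i, hi⟩ p hp).2
  · intro t ht i hi
    rw [(hline q₀ hq₀U t ht).deriv, hode q₀ hq₀U t ht i hi]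
    simp [hi]
  · intro p hp
    rw [(hline q₀ hq₀U _ hp.1).deriv, hode q₀ hq₀U _ hp.1 1 (by decide), ← hF p hp,
      ← (heq p hp).1 0]
    have := h.diag p hp 1
    rw [(hακ ⟨1, by decide⟩ p hp).1] at this
    linear_combination -this

end Rigidity

/-! ### Uniqueness of the conformal Killing vector -/

section Families

variable {I : Set ℝ} {V : Set (Fin 3 → ℝ)} {G : Fin 4 → ℝ → ℝ} {p : Pt}

theorem rate_eq_of_hasDerivAt {i : Fin 4} {t g : ℝ} (h : HasDerivAt (G i) (2 * g * G i t) t)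
    (h0 : G i t ≠ 0) : rate G i t = g := by
  rw [rate, h.deriv]; field_simp

/-- Two solutions of a scalar linear homogeneous equation are proportional. -/
theorem exists_eq_mul_of_linear_ode {h y z : ℝ → ℝ} (hI : IsOpenInterval I)
    (hy : ∀ t ∈ I, HasDerivAt y (h t * y t) t) (hz : ∀ t ∈ I, HasDerivAt z (h t * z t) t)
    (hz0 : ∀ t ∈ I, z t ≠ 0) : ∃ c, ∀ t ∈ I, y t = c * z t := by
  obtain ⟨c, hc⟩ := eqOn_const_of_hasDerivAt (y := fun t => y t / z t) hI fun t ht =>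
    ((hy t ht).div (hz t ht) (hz0 t ht)).congr_deriv (by ring)
  exact ⟨c, fun t ht => (div_eq_iff (hz0 t ht)).1 (hc t ht)⟩

theorem exists_rate_eq_of_isLRSOn (hI : IsOpen I) (hG : ∀ i, IsScaleFactor I (G i))
    (hV : V.Nonempty) (h : IsLRSOn (diagMetric G) (region I V)) :
    ∃ i j : Fin 4, i ≠ 0 ∧ j ≠ 0 ∧ i ≠ j ∧ ∀ t ∈ I, rate G i t = rate G j t := by
  obtain ⟨i, j, hij, k, hk⟩ := h
  obtain ⟨x, hx⟩ := hV
  refine ⟨i.succ, j.succ, Fin.succ_ne_zero i, Fin.succ_ne_zero j,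
    fun h => hij (Fin.succ_injective _ h), fun t ht => ?_⟩
  have hE : EqOn (G i.succ) (fun t => k * G j.succ t) I := fun s hs => by
    simpa [diagMetric_apply] using hk _ (cons_mem_region hs hx)
  refine rate_eq_of_hasDerivAt ?_ ((hG _).2 t ht)
  have hd := ((hasDerivAt_scale hI hG j.succ ht).const_mul k).congr_of_eventuallyEq
    (hE.eventuallyEq_of_mem (hI.mem_nhds ht))
  refine hd.congr_deriv ?_
  rw [hE ht]; ring

/-- Conformal invariance: a common summand `ρ` of all rates, such as `C'/C`, cancels. -/
theorem weylDiff_eq_of_rate (hI : IsOpen I) (hG : ∀ i, IsScaleFactor I (G i)) {ρ : ℝ → ℝ}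
    {e : Fin 4 → ℝ → ℝ} {e' : Fin 4 → ℝ} (hr : ∀ i, ∀ t ∈ I, rate G i t = ρ t + e i t) {t : ℝ}
    (ht : t ∈ I) (he : ∀ i, HasDerivAt (e i) (e' i) t) (i j k : Fin 4) :
    weylDiff G i j k t = e' i - e' j + (e i t - e j t) * (e i t + e j t - e k t - e 0 t) := by
  have h₁ := (hasDerivAt_rate hI hG i ht).sub (hasDerivAt_rate hI hG j ht)
  have h₂ : HasDerivAt (rate G i - rate G j) (e' i - e' j) t := by
    refine ((he i).sub (he j)).congr_of_eventuallyEq ?_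
    filter_upwards [hI.mem_nhds ht] with s hs
    simp [hr _ s hs]
  rw [weylDiff, h₁.unique h₂, hr i t ht, hr j t ht, hr k t ht, hr 0 t ht]
  ring

theorem IsCKV.factor_eq (hI : IsOpen I) (hG : ∀ i, IsScaleFactor I (G i)) {X : Pt → Pt}
    {ψ φ : Pt → ℝ} (hψ : IsCKV (diagMetric G) (region I V) X ψ)
    (hφ : IsCKV (diagMetric G) (region I V) X φ) : ∀ p ∈ region I V, φ p = ψ p := fun p hp => by
  rw [← (((isCKV_diagMetric_iff hI hG X ψ).1 hψ).2 p hp).1 0,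
    ← (((isCKV_diagMetric_iff hI hG X φ).1 hφ).2 p hp).1 0]

theorem IsCKV.congr_factor {g : Metric} {U : Set Pt} {X : Pt → Pt} {ψ φ : Pt → ℝ}
    (h : IsCKV g U X ψ) (hφ : ∀ p ∈ U, φ p = ψ p) : IsCKV g U X φ :=
  ⟨h.1, fun p hp a b => by rw [hφ p hp]; exact h.2 p hp a b⟩

theorem isProperHV_iff (hI : IsOpen I) (hG : ∀ i, IsScaleFactor I (G i)) {X : Pt → Pt}
    {ψ : Pt → ℝ} (h : IsCKV (diagMetric G) (region I V) X ψ) :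
    IsProperHV (diagMetric G) (region I V) X ↔ ∃ k : ℝ, k ≠ 0 ∧ ∀ p ∈ region I V, ψ p = k :=
  exists_congr fun _ => and_congr_right fun _ =>
    ⟨fun hk => hk.factor_eq hI hG h, fun hk => h.congr_factor fun p hp => (hk p hp).symm⟩

/-- Rigidity reduces uniqueness of the CKV to `huniq`, a statement on ordinary differential
equations. -/
theorem hasUniqueCKV_of_diagonalCKV (hI : IsOpenInterval I) (hV : IsOpen V) (hVc : IsConnected V)
    (hG : ∀ i, IsScaleFactor I (G i)) (hLRS : ¬ IsLRSOn (diagMetric G) (region I V))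
    (hCF : ¬ ConformallyFlatOn (diagMetric G) (region I V)) {X : Pt → Pt} {ψ : Pt → ℝ}
    {F₀ : ℝ → ℝ} {α₀ : Fin 4 → ℝ} (hX : DiagonalCKV I V G X ψ F₀ α₀ 0)
    (huniq : ∀ (F : ℝ → ℝ) (α : Fin 4 → ℝ), (∀ t ∈ I, ∀ i, i ≠ 0 →
      deriv F t = (rate G i t - rate G 0 t) * F t + α i) →
      ∃ μ : ℝ, (∀ t ∈ I, F t = μ * F₀ t) ∧ ∀ i, i ≠ 0 → α i = μ * α₀ i) :
    HasUniqueCKV (diagMetric G) (region I V) X ψ := by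
  have hXC := hX.isCKV hI.1 hV hG
  have hiff : ∀ (Y : Pt → Pt) (φ : Pt → ℝ), IsCKV (diagMetric G) (region I V) Y φ ↔
      ∃ (μ : ℝ) (κ : Fin 3 → ℝ), ∀ p ∈ region I V, Y p = μ • X p + translation κ ∧
        φ p = μ * ψ p := by
    intro Y φ
    constructor
    · intro hY
      obtain ⟨F, α, κ, h⟩ := hY.exists_diagonalCKV hI hV hVc hG hLRS hCF
      obtain ⟨μ, hF, hα⟩ := huniq F α h.eq
      refine ⟨μ, fun i => κ i.succ, fun p hp => ⟨?_, ?_⟩⟩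
      · have hs : ∀ i, i ≠ 0 → Y p i = μ * X p i + κ i := fun i hi => by
          rw [h.space p hp i hi, hX.space p hp i hi, hα i hi]; simp; ring
        funext i
        fin_cases i
        · simp [translation, h.time p hp, hX.time p hp, hF _ hp.1]
        · simpa [translation] using hs 1 (by decide)
        · simpa [translation] using hs 2 (by decide)
        · simpa [translation] using hs 3 (by decide)
      · have hd : deriv F (p 0) = μ * deriv F₀ (p 0) := by
          rw [h.eq _ hp.1 1 (by decide), hX.eq _ hp.1 1 (by decide), hF _ hp.1, hα 1 (by decide)]
          ring
        rw [h.factor p hp, hX.factor p hp, hF _ hp.1, hd]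
        ring
    · rintro ⟨μ, κ, h⟩
      refine DiagonalCKV.isCKV (F := fun t => μ * F₀ t) (α := fun i => μ * α₀ i)
        (κ := translation κ) hI.1 hV hG ⟨contDiffOn_const.mul hX.smooth, fun p hp => ?_,
        fun p hp i hi => ?_, fun t ht i hi => ?_, fun p hp => ?_⟩
      · simp [(h p hp).1, hX.time p hp, translation]
      · simp [(h p hp).1, hX.space p hp i hi]
        ring
      · have := (hasDerivAt_of_smoothOn hI.1 hX.smooth ht).const_mul μ
        rw [this.deriv, hX.eq t ht i hi]; ring
      · have := (hasDerivAt_of_smoothOn hI.1 hX.smooth hp.1).const_mul μ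
        rw [(h p hp).2, this.deriv, hX.factor p hp]; ring
  refine ⟨hXC, hiff, fun hψ => ⟨⟨ψ, hXC, hψ⟩, ?_⟩⟩
  rintro Y ⟨φ, hY, hφ⟩
  obtain ⟨μ, κ, h⟩ := (hiff Y φ).1 hY
  refine ⟨μ, κ, ?_, fun p hp => (h p hp).1⟩
  -- With `μ = 0` the conformal factor would be the constant `0`.
  rintro rfl
  exact hφ ⟨0, fun p hp => by rw [(h p hp).2, zero_mul]⟩

/-- The entries of a metric conformal to `diagMetric E` with conformal factor `C ^ 2`. -/
def conformalEntries (C : ℝ → ℝ) (E : Fin 4 → ℝ → ℝ) : Fin 4 → ℝ → ℝ := fun i t => C t ^ 2 * E i t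

theorem isScaleFactor_conformalEntries {C : ℝ → ℝ} {E : Fin 4 → ℝ → ℝ} (hC : IsScaleFactor I C)
    (hE : ∀ i, IsScaleFactor I (E i)) (i : Fin 4) : IsScaleFactor I (conformalEntries C E i) :=
  ⟨(hC.1.pow 2).mul (hE i).1, fun t ht => mul_ne_zero (pow_ne_zero 2 (hC.2 t ht)) ((hE i).2 t ht)⟩

theorem rate_conformalEntries {C : ℝ → ℝ} {E : Fin 4 → ℝ → ℝ} (hI : IsOpen I)
    (hC : IsScaleFactor I C) {i : Fin 4} {t e : ℝ} (ht : t ∈ I)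
    (hE : HasDerivAt (E i) (2 * e * E i t) t) (hE0 : E i t ≠ 0) :
    rate (conformalEntries C E) i t = deriv C t / C t + e := by
  have hC0 := hC.2 t ht
  refine rate_eq_of_hasDerivAt ?_ (mul_ne_zero (pow_ne_zero 2 hC0) hE0)
  refine (((hasDerivAt_of_smoothOn hI hC.1 ht).pow 2).mul hE).congr_deriv ?_
  simp only [conformalEntries]
  field_simp
  simp
  ring

theorem deriv_log_abs {C : ℝ → ℝ} (hI : IsOpen I) (hC : IsScaleFactor I C) {t : ℝ} (ht : t ∈ I) :
    deriv (fun s => Real.log |C s|) t = deriv C t / C t := by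
  simp only [Real.log_abs]
  exact ((hasDerivAt_of_smoothOn hI hC.1 ht).log (hC.2 t ht)).deriv

end Families

/-! ### The first family -/

section FirstFamily

variable {J : Set ℝ} {V : Set (Fin 3 → ℝ)} {C : ℝ → ℝ} {c α₁ : ℝ}

/-- Entries of the first family without the conformal factor. -/
noncomputable def entriesB1 (c α₁ : ℝ) : Fin 4 → ℝ → ℝ :=
  ![fun _ => -1, fun t => Real.exp (-(2 / c) * t), fun t => Real.exp (-(2 * α₁ / c) * t), fun _ => 1]

/-- Rates of `entriesB1`. -/
noncomputable def ratesB1 (c α₁ : ℝ) : Fin 4 → ℝ := ![0, -(1 / c), -(α₁ / c), 0]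

theorem metricB1_eq (c α₁ : ℝ) (C : ℝ → ℝ) :
    metricB1 c α₁ C = diagMetric (conformalEntries C (entriesB1 c α₁)) := by
  funext p
  rw [metricB1, diagMetric, ← Matrix.diagonal_smul]
  congr 1
  funext i
  fin_cases i <;> simp [conformalEntries, entriesB1]

theorem isScaleFactor_entriesB1 (i : Fin 4) : IsScaleFactor J (entriesB1 c α₁ i) := by
  fin_cases i
  · exact ⟨contDiffOn_const, fun t _ => by norm_num [entriesB1]⟩
  · exact ⟨(contDiff_const.mul contDiff_id).exp.contDiffOn, fun _ _ => Real.exp_ne_zero _⟩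
  · exact ⟨(contDiff_const.mul contDiff_id).exp.contDiffOn, fun _ _ => Real.exp_ne_zero _⟩
  · exact ⟨contDiffOn_const, fun _ _ => one_ne_zero⟩

theorem isScaleFactor_B1 (hC : IsScaleFactor J C) (i : Fin 4) :
    IsScaleFactor J (conformalEntries C (entriesB1 c α₁) i) :=
  isScaleFactor_conformalEntries hC isScaleFactor_entriesB1 i

theorem hasDerivAt_exp_mul (a t : ℝ) :
    HasDerivAt (fun t => Real.exp (a * t)) (a * Real.exp (a * t)) t := by
  simpa [mul_comm] using ((hasDerivAt_id t).const_mul a).exp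

theorem rate_B1 (hJ : IsOpen J) (hC : IsScaleFactor J C) (i : Fin 4) {t : ℝ} (ht : t ∈ J) :
    rate (conformalEntries C (entriesB1 c α₁)) i t = deriv C t / C t + ratesB1 c α₁ i := by
  refine rate_conformalEntries hJ hC ht ?_ ((isScaleFactor_entriesB1 (J := J) i).2 t ht)
  fin_cases i
  · simpa [entriesB1, ratesB1] using hasDerivAt_const t (-1 : ℝ)
  · refine (hasDerivAt_exp_mul (-(2 / c)) t).congr_deriv ?_
    simp [entriesB1, ratesB1]; ring
  · refine (hasDerivAt_exp_mul (-(2 * α₁ / c)) t).congr_deriv ?_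
    simp [entriesB1, ratesB1]; ring
  · simpa [entriesB1, ratesB1] using hasDerivAt_const t (1 : ℝ)

theorem axes_pairwise_ne {r : Fin 4 → ℝ} (h₁₂ : r 1 ≠ r 2) (h₁₃ : r 1 ≠ r 3) (h₂₃ : r 2 ≠ r 3)
    {i j : Fin 4} (hi : i ≠ 0) (hj : j ≠ 0) (hij : i ≠ j) : r i ≠ r j := by
  fin_cases i <;> fin_cases j <;>
  first
    | exact absurd rfl hi | exact absurd rfl hj | exact absurd rfl hij | exact h₁₂ | exact h₁₃
    | exact h₂₃ | exact h₁₂.symm | exact h₁₃.symm | exact h₂₃.symm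

theorem not_isLRSOn_B1 (hp : ParamsB1 c α₁) (hJ : IsOpenInterval J) (hV : V.Nonempty)
    (hC : IsScaleFactor J C) : ¬ IsLRSOn (metricB1 c α₁ C) (region J V) := by
  obtain ⟨hc, h0, h1⟩ := hp
  rw [metricB1_eq]
  intro h
  obtain ⟨i, j, hi, hj, hij, h⟩ := exists_rate_eq_of_isLRSOn hJ.1 (isScaleFactor_B1 hC) hV h
  obtain ⟨t, ht⟩ := hJ.2.2
  have e := h t ht
  rw [rate_B1 hJ.1 hC i ht, rate_B1 hJ.1 hC j ht, add_right_inj] at e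
  refine axes_pairwise_ne ?_ ?_ ?_ hi hj hij e
  · simp [ratesB1, div_eq_mul_inv, hc]
    exact h1
  · simp [ratesB1, hc]
  · simp [ratesB1, hc, h0]

theorem not_conformallyFlatOn_B1 (hp : ParamsB1 c α₁) (hJ : IsOpenInterval J) (hV : V.Nonempty)
    (hC : IsScaleFactor J C) : ¬ ConformallyFlatOn (metricB1 c α₁ C) (region J V) := by
  obtain ⟨hc, h0, h1⟩ := hp
  rw [metricB1_eq]
  intro h
  obtain ⟨t, ht⟩ := hJ.2.2
  have e := (weylDiff_eq_zero_of_conformallyFlatOn hJ.1 (isScaleFactor_B1 hC) hV h ht).2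
  rw [weylDiff_eq_of_rate (e := fun i _ => ratesB1 c α₁ i) (e' := 0) hJ.1 (isScaleFactor_B1 hC)
    (fun i t ht => rate_B1 hJ.1 hC i ht) ht (fun i => hasDerivAt_const _ _)] at e
  have : α₁ * (α₁ - 1) / c ^ 2 = 0 := by
    rw [← e]
    simp [ratesB1]
    ring
  rcases mul_eq_zero.mp ((div_eq_zero_iff.mp this).resolve_right (pow_ne_zero 2 hc)) with h | h
  · exact h0 h
  · exact h1 (by linear_combination h)

theorem diagonalCKV_B1 (hp : ParamsB1 c α₁) (hJ : IsOpen J) (hC : IsScaleFactor J C) :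
    DiagonalCKV J V (conformalEntries C (entriesB1 c α₁)) (fieldB1 c α₁) (factorB1 c C)
      (fun _ => c) ![0, 1, α₁, 0] 0 := by
  obtain ⟨hc, h0, h1⟩ := hp
  refine ⟨contDiffOn_const, fun p _ => rfl, fun p _ i hi => ?_, fun t ht i hi => ?_, fun p hp => ?_⟩
  · fin_cases i <;> simp [fieldB1] at *
  · rw [rate_B1 hJ hC i ht, rate_B1 hJ hC 0 ht]
    fin_cases i <;> simp [ratesB1] at * <;> field_simp <;> simp
  · rw [factorB1, deriv_log_abs hJ hC hp.1, rate_B1 hJ hC 0 hp.1]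
    simp [ratesB1]; ring

theorem hasUniqueCKV_B1 (hp : ParamsB1 c α₁) (hJ : IsOpenInterval J) (hV : IsOpen V)
    (hVc : IsConnected V) (hC : IsScaleFactor J C) :
    HasUniqueCKV (metricB1 c α₁ C) (region J V) (fieldB1 c α₁) (factorB1 c C) := by
  have hLRS := not_isLRSOn_B1 hp hJ hVc.nonempty hC
  have hCF := not_conformallyFlatOn_B1 hp hJ hVc.nonempty hC
  rw [metricB1_eq] at *
  refine hasUniqueCKV_of_diagonalCKV hJ hV hVc (isScaleFactor_B1 hC) hLRS hCF
    (diagonalCKV_B1 hp hJ.1 hC) fun F α h => ?_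
  obtain ⟨hc, h0, h1⟩ := hp
  have h' : ∀ t ∈ J, ∀ i, i ≠ 0 → deriv F t = (ratesB1 c α₁ i - ratesB1 c α₁ 0) * F t + α i :=
    fun t ht i hi => by rw [h t ht i hi, rate_B1 hJ.1 hC i ht, rate_B1 hJ.1 hC 0 ht]; ring
  -- Axis `3` gives `F' = α 3`, and axis `1` then determines `F` algebraically. Since `F` turns out
  -- constant, `α 3 = 0`.
  have hF : EqOn F (fun _ => c * (α 1 - α 3)) J := fun t ht => by
    have e₁ := h' t ht 1 (by decide)
    have e₃ := h' t ht 3 (by decide)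
    simp [ratesB1] at e₁ e₃
    rw [e₃] at e₁
    field_simp at e₁ ⊢
    linear_combination e₁
  obtain ⟨t, ht⟩ := hJ.2.2
  have hd : deriv F t = 0 := by rw [hF.deriv hJ.1 ht]; simp
  have e₁ := h' t ht 1 (by decide)
  have e₂ := h' t ht 2 (by decide)
  have e₃ := h' t ht 3 (by decide)
  rw [hd, hF ht] at e₁ e₂ e₃
  simp [ratesB1] at e₁ e₂ e₃
  refine ⟨α 1, fun t ht => by rw [hF ht, ← e₃]; ring, fun i hi => ?_⟩
  field_simp at e₂
  fin_cases i
  · exact absurd rfl hi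
  · simp
  · simp; rw [← e₃] at e₂; linear_combination -e₂
  · simp [← e₃]

theorem forall_mem_region {P : ℝ → Prop} (hV : V.Nonempty) :
    (∀ p ∈ region J V, P (p 0)) ↔ ∀ t ∈ J, P t := by
  obtain ⟨x, hx⟩ := hV
  exact ⟨fun h t ht => by simpa using h _ (cons_mem_region ht hx), fun h p hp => h _ hp.1⟩

theorem isProperHV_B1_iff (hp : ParamsB1 c α₁) (hJ : IsOpenInterval J) (hV : IsOpen V)
    (hVc : IsConnected V) (hC : IsScaleFactor J C) :
    IsProperHV (metricB1 c α₁ C) (region J V) (fieldB1 c α₁) ↔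
      ∃ ψ₀ k : ℝ, ψ₀ ≠ 0 ∧ ∀ τ ∈ J, C τ = k * Real.exp (ψ₀ * τ) := by
  rw [metricB1_eq, isProperHV_iff hJ.1 (isScaleFactor_B1 hC)
    ((diagonalCKV_B1 hp hJ.1 hC).isCKV hJ.1 hV (isScaleFactor_B1 hC))]
  obtain ⟨hc, h0, h1⟩ := hp
  constructor
  · rintro ⟨k, hk, h⟩
    -- A constant factor `k` means `C'/C = k / c`.
    obtain ⟨d, hd⟩ := exists_eq_mul_of_linear_ode (h := fun _ => k / c) hJ (y := C)
      (fun t ht => (hasDerivAt_of_smoothOn hJ.1 hC.1 ht).congr_deriv (by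
        have := (forall_mem_region (P := fun t => c * deriv (fun s => Real.log |C s|) t = k)
          hVc.nonempty).1 h t ht
        rw [deriv_log_abs hJ.1 hC ht] at this
        have hC0 := hC.2 t ht
        field_simp at this ⊢
        exact this)) (fun t _ => hasDerivAt_exp_mul (k / c) t) (fun _ _ => Real.exp_ne_zero _)
    exact ⟨k / c, d, div_ne_zero hk hc, hd⟩
  · rintro ⟨ψ₀, k, hψ, h⟩
    refine ⟨c * ψ₀, mul_ne_zero hc hψ, fun p hp => ?_⟩
    have hE : EqOn C (fun t => k * Real.exp (ψ₀ * t)) J := h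
    have hC0 := hC.2 _ hp.1
    rw [factorB1, deriv_log_abs hJ.1 hC hp.1, hE.deriv hJ.1 hp.1,
      ((hasDerivAt_exp_mul ψ₀ (p 0)).const_mul k).deriv]
    rw [h _ hp.1] at hC0 ⊢
    have hk : k ≠ 0 := left_ne_zero_of_mul hC0
    field_simp

end FirstFamily

/-! ### The second family -/

section SecondFamily

variable {J : Set ℝ} {V : Set (Fin 3 → ℝ)} {C : ℝ → ℝ} {α₁ α₂ : ℝ}

/-- Entries of the second family without the conformal factor. -/
noncomputable def entriesB2 (α₁ α₂ : ℝ) : Fin 4 → ℝ → ℝ :=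
  ![fun _ => -1, fun t => t ^ (2 * ((α₂ - 1) / α₂)), fun t => t ^ (2 * ((α₂ - α₁) / α₂)), fun _ => 1]

/-- Exponents of the square roots of `entriesB2`. -/
noncomputable def exponentsB2 (α₁ α₂ : ℝ) : Fin 4 → ℝ :=
  ![0, (α₂ - 1) / α₂, (α₂ - α₁) / α₂, 0]

theorem metricB2_eq (α₁ α₂ : ℝ) (C : ℝ → ℝ) :
    metricB2 α₁ α₂ C = diagMetric (conformalEntries C (entriesB2 α₁ α₂)) := by
  funext p
  rw [metricB2, diagMetric, ← Matrix.diagonal_smul]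
  congr 1
  funext i
  fin_cases i <;> simp [conformalEntries, entriesB2]

theorem isScaleFactor_rpow (hJ : J ⊆ Ioi 0) (a : ℝ) : IsScaleFactor J (fun t => t ^ a) :=
  ⟨fun _ ht => (Real.contDiffAt_rpow_const_of_ne (ne_of_gt (hJ ht))).contDiffWithinAt,
    fun _ ht => (Real.rpow_pos_of_pos (hJ ht) _).ne'⟩

theorem isScaleFactor_entriesB2 (hJ : J ⊆ Ioi 0) (i : Fin 4) :
    IsScaleFactor J (entriesB2 α₁ α₂ i) := by
  fin_cases i
  · exact ⟨contDiffOn_const, fun _ _ => by norm_num [entriesB2]⟩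
  · exact isScaleFactor_rpow hJ _
  · exact isScaleFactor_rpow hJ _
  · exact ⟨contDiffOn_const, fun _ _ => one_ne_zero⟩

theorem isScaleFactor_B2 (hJ : J ⊆ Ioi 0) (hC : IsScaleFactor J C) (i : Fin 4) :
    IsScaleFactor J (conformalEntries C (entriesB2 α₁ α₂) i) :=
  isScaleFactor_conformalEntries hC (isScaleFactor_entriesB2 hJ) i

theorem hasDerivAt_rpow_of_pos (a : ℝ) {t : ℝ} (ht : 0 < t) :
    HasDerivAt (fun t => t ^ a) (a / t * t ^ a) t := by
  refine (Real.hasDerivAt_rpow_const (Or.inl ht.ne')).congr_deriv ?_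
  rw [Real.rpow_sub_one ht.ne']; ring

theorem rate_B2 (hJo : IsOpen J) (hJ : J ⊆ Ioi 0) (hC : IsScaleFactor J C) (i : Fin 4) {t : ℝ}
    (ht : t ∈ J) : rate (conformalEntries C (entriesB2 α₁ α₂)) i t
      = deriv C t / C t + exponentsB2 α₁ α₂ i / t := by
  refine rate_conformalEntries hJo hC ht ?_ ((isScaleFactor_entriesB2 hJ i).2 t ht)
  fin_cases i
  · simpa [entriesB2, exponentsB2] using hasDerivAt_const t (-1 : ℝ)
  · refine (hasDerivAt_rpow_of_pos _ (hJ ht)).congr_deriv ?_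
    simp [entriesB2, exponentsB2]; ring_nf; simp
  · refine (hasDerivAt_rpow_of_pos _ (hJ ht)).congr_deriv ?_
    simp [entriesB2, exponentsB2]; ring_nf; simp
  · simpa [entriesB2, exponentsB2] using hasDerivAt_const t (1 : ℝ)

theorem not_isLRSOn_B2 (hp : ParamsB2 α₁ α₂) (hJ : IsOpenInterval J) (hJ0 : J ⊆ Ioi 0)
    (hV : V.Nonempty) (hC : IsScaleFactor J C) :
    ¬ IsLRSOn (metricB2 α₁ α₂ C) (region J V) := by
  obtain ⟨h0, h1, h2, h3⟩ := hp
  rw [metricB2_eq]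
  intro h
  obtain ⟨i, j, hi, hj, hij, h⟩ := exists_rate_eq_of_isLRSOn hJ.1 (isScaleFactor_B2 hJ0 hC) hV h
  obtain ⟨t, ht⟩ := hJ.2.2
  have ht0 : t ≠ 0 := ne_of_gt (hJ0 ht)
  have e := h t ht
  rw [rate_B2 hJ.1 hJ0 hC i ht, rate_B2 hJ.1 hJ0 hC j ht, add_right_inj,
    div_left_inj' ht0] at e
  have n1 : α₂ - 1 ≠ 0 := sub_ne_zero.2 h1
  have n2 : α₂ - α₁ ≠ 0 := sub_ne_zero.2 h2.symm
  refine axes_pairwise_ne ?_ ?_ ?_ hi hj hij e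
  · simp [exponentsB2, div_left_inj' h0, h3.symm]
  · simp [exponentsB2, h0, n1]
  · simp [exponentsB2, h0, n2]

theorem not_conformallyFlatOn_B2 (hp : ParamsB2 α₁ α₂) (hJ : IsOpenInterval J) (hJ0 : J ⊆ Ioi 0)
    (hV : V.Nonempty) (hC : IsScaleFactor J C) :
    ¬ ConformallyFlatOn (metricB2 α₁ α₂ C) (region J V) := by
  obtain ⟨h0, h1, h2, h3⟩ := hp
  rw [metricB2_eq]
  intro h
  obtain ⟨t, ht⟩ := hJ.2.2
  have ht0 : t ≠ 0 := ne_of_gt (hJ0 ht)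
  obtain ⟨e₁, e₂⟩ := weylDiff_eq_zero_of_conformallyFlatOn hJ.1 (isScaleFactor_B2 hJ0 hC) hV h ht
  have hd : ∀ i, HasDerivAt (fun s => exponentsB2 α₁ α₂ i / s) (-(exponentsB2 α₁ α₂ i / t ^ 2)) t :=
    fun i => ((hasDerivAt_inv ht0).const_mul (exponentsB2 α₁ α₂ i)).congr_deriv (by ring)
  rw [weylDiff_eq_of_rate hJ.1 (isScaleFactor_B2 hJ0 hC)
    (fun i t ht => rate_B2 hJ.1 hJ0 hC i ht) ht hd] at e₁ e₂
  set m := exponentsB2 α₁ α₂ 1 with hm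
  set n := exponentsB2 α₁ α₂ 2 with hn
  have hm0 : m ≠ 0 := div_ne_zero (sub_ne_zero.2 h1) h0
  have hn0 : n ≠ 0 := div_ne_zero (sub_ne_zero.2 h2.symm) h0
  have h3 : exponentsB2 α₁ α₂ 3 = 0 := rfl
  have h0 : exponentsB2 α₁ α₂ 0 = 0 := rfl
  rw [h3, h0] at e₁ e₂
  field_simp at e₁ e₂
  -- Since `m` and `n` are nonzero, flatness would require both `m - n = 1` and `n - m = 1`.
  have f₁ : m * (m - n - 1) = 0 := by linear_combination e₁
  have f₂ : n * (n - m - 1) = 0 := by linear_combination e₂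
  have g₁ := (mul_eq_zero.mp f₁).resolve_left hm0
  have g₂ := (mul_eq_zero.mp f₂).resolve_left hn0
  linarith

theorem diagonalCKV_B2 (hp : ParamsB2 α₁ α₂) (hJ : IsOpen J) (hJ0 : J ⊆ Ioi 0)
    (hC : IsScaleFactor J C) :
    DiagonalCKV J V (conformalEntries C (entriesB2 α₁ α₂)) (fieldB2 α₁ α₂) (factorB2 α₂ C)
      (fun t => α₂ * t) ![0, 1, α₁, α₂] 0 := by
  obtain ⟨h0, h1, h2, h3⟩ := hp
  have hd : ∀ t, deriv (fun t => α₂ * t) t = α₂ := fun t => by simp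
  refine ⟨(contDiff_const.mul contDiff_id).contDiffOn, fun p _ => rfl, fun p _ i hi => ?_,
    fun t ht i hi => ?_, fun p hp => ?_⟩
  · fin_cases i <;> simp [fieldB2] at *
  · have ht0 : t ≠ 0 := ne_of_gt (hJ0 ht)
    rw [rate_B2 hJ hJ0 hC i ht, rate_B2 hJ hJ0 hC 0 ht, hd]
    fin_cases i <;> simp [exponentsB2] at * <;> field_simp <;> simp
  · rw [factorB2, deriv_log_abs hJ hC hp.1, rate_B2 hJ hJ0 hC 0 hp.1, hd]
    simp [exponentsB2]; ring

theorem hasUniqueCKV_B2 (hp : ParamsB2 α₁ α₂) (hJ : IsOpenInterval J) (hJ0 : J ⊆ Ioi 0)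
    (hV : IsOpen V) (hVc : IsConnected V) (hC : IsScaleFactor J C) :
    HasUniqueCKV (metricB2 α₁ α₂ C) (region J V) (fieldB2 α₁ α₂) (factorB2 α₂ C) := by
  have hLRS := not_isLRSOn_B2 hp hJ hJ0 hVc.nonempty hC
  have hCF := not_conformallyFlatOn_B2 hp hJ hJ0 hVc.nonempty hC
  rw [metricB2_eq] at *
  refine hasUniqueCKV_of_diagonalCKV hJ hV hVc (isScaleFactor_B2 hJ0 hC) hLRS hCF
    (diagonalCKV_B2 hp hJ.1 hJ0 hC) fun F α h => ?_
  obtain ⟨h0, h1, h2, h3⟩ := hp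
  have n1 : α₂ - 1 ≠ 0 := sub_ne_zero.2 h1
  have h' : ∀ t ∈ J, ∀ i, i ≠ 0 →
      deriv F t = (exponentsB2 α₁ α₂ i - exponentsB2 α₁ α₂ 0) / t * F t + α i :=
    fun t ht i hi => by rw [h t ht i hi, rate_B2 hJ.1 hJ0 hC i ht, rate_B2 hJ.1 hJ0 hC 0 ht]; ring
  -- Axis `3` gives `F' = α 3`, and axis `1` makes `F` a multiple of `t`. Comparing the slope with
  -- `α 3` yields `α 3 = α₂ * α 1`.
  have hF : EqOn F (fun t => (α 3 - α 1) * α₂ / (α₂ - 1) * t) J := fun t ht => by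
    have ht0 : t ≠ 0 := ne_of_gt (hJ0 ht)
    have e₁ := h' t ht 1 (by decide)
    have e₃ := h' t ht 3 (by decide)
    simp [exponentsB2] at e₁ e₃
    rw [e₃] at e₁
    field_simp at e₁ ⊢
    linear_combination -e₁
  obtain ⟨t, ht⟩ := hJ.2.2
  have ht0 : t ≠ 0 := ne_of_gt (hJ0 ht)
  have hd : deriv F t = (α 3 - α 1) * α₂ / (α₂ - 1) := by rw [hF.deriv hJ.1 ht]; simp
  have e₂ := h' t ht 2 (by decide)
  have e₃ := h' t ht 3 (by decide)
  rw [hd, hF ht] at e₂ e₃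
  simp [exponentsB2] at e₂ e₃
  field_simp at e₂ e₃
  have e₄ : α 3 = α₂ * α 1 := by linear_combination e₃
  refine ⟨α 1, fun t ht => by rw [hF ht, e₄]; field_simp, fun i hi => ?_⟩
  rw [e₄] at e₂
  fin_cases i
  · exact absurd rfl hi
  · simp
  · simp
    refine mul_left_cancel₀ n1 ?_
    linear_combination -e₂
  · simp [e₄, mul_comm]

theorem isProperHV_B2_iff (hp : ParamsB2 α₁ α₂) (hJ : IsOpenInterval J) (hJ0 : J ⊆ Ioi 0)
    (hV : IsOpen V) (hVc : IsConnected V) (hC : IsScaleFactor J C) :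
    IsProperHV (metricB2 α₁ α₂ C) (region J V) (fieldB2 α₁ α₂) ↔
      ∃ ψ₀ k : ℝ, ψ₀ ≠ 0 ∧ ∀ τ ∈ J, C τ = k * τ ^ (ψ₀ - 1) := by
  rw [metricB2_eq, isProperHV_iff hJ.1 (isScaleFactor_B2 hJ0 hC)
    ((diagonalCKV_B2 hp hJ.1 hJ0 hC).isCKV hJ.1 hV (isScaleFactor_B2 hJ0 hC))]
  obtain ⟨h0, h1, h2, h3⟩ := hp
  constructor
  · rintro ⟨k, hk, h⟩
    -- A constant factor `k` means `C'/C = (k / α₂ - 1) / τ`, whence `ψ₀ = k / α₂`.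
    obtain ⟨d, hd⟩ := exists_eq_mul_of_linear_ode (h := fun t => (k / α₂ - 1) / t) hJ (y := C)
      (fun t ht => (hasDerivAt_of_smoothOn hJ.1 hC.1 ht).congr_deriv (by
        have := (forall_mem_region
          (P := fun t => α₂ * (1 + t * deriv (fun s => Real.log |C s|) t) = k)
          hVc.nonempty).1 h t ht
        rw [deriv_log_abs hJ.1 hC ht] at this
        have hC0 := hC.2 t ht
        have ht0 : t ≠ 0 := ne_of_gt (hJ0 ht)
        field_simp at this ⊢
        linear_combination this)) (fun t ht => hasDerivAt_rpow_of_pos (k / α₂ - 1) (hJ0 ht))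
        (fun t ht => (isScaleFactor_rpow hJ0 _).2 t ht)
    exact ⟨k / α₂, d, div_ne_zero hk h0, hd⟩
  · rintro ⟨ψ₀, k, hψ, h⟩
    refine ⟨α₂ * ψ₀, mul_ne_zero h0 hψ, fun p hp => ?_⟩
    have hE : EqOn C (fun t => k * t ^ (ψ₀ - 1)) J := h
    have hC0 := hC.2 _ hp.1
    have hp0 : p 0 ≠ 0 := ne_of_gt (hJ0 hp.1)
    rw [factorB2, deriv_log_abs hJ.1 hC hp.1, hE.deriv hJ.1 hp.1,
      ((hasDerivAt_rpow_of_pos (ψ₀ - 1) (hJ0 hp.1)).const_mul k).deriv]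
    rw [h _ hp.1] at hC0 ⊢
    have hk : k ≠ 0 := left_ne_zero_of_mul hC0
    have hr : p 0 ^ (ψ₀ - 1) ≠ 0 := right_ne_zero_of_mul hC0
    field_simp
    ring

end SecondFamily

/-! ### Time changes and Bianchi I metrics -/

section TimeChange

variable {I : Set ℝ} {V : Set (Fin 3 → ℝ)} {G : Fin 4 → ℝ → ℝ} {p : Pt}

theorem injOn_of_deriv_ne_zero {θ : ℝ → ℝ} (hI : IsOpenInterval I) (hθ : ContDiffOn ℝ ∞ θ I)
    (hd : ∀ t ∈ I, deriv θ t ≠ 0) : InjOn θ I := by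
  have key : ∀ a ∈ I, ∀ b ∈ I, a < b → θ a ≠ θ b := by
    intro a ha b hb hab heq
    have hsub : Icc a b ⊆ I := hI.2.1.out ha hb
    obtain ⟨c, hc, hc0⟩ := exists_deriv_eq_zero hab (hθ.continuousOn.mono hsub) heq
    exact hd c (hsub ⟨hc.1.le, hc.2.le⟩) hc0
  intro a ha b hb heq
  rcases lt_trichotomy a b with h | h | h
  · exact absurd heq (key a ha b hb h)
  · exact h
  · exact absurd heq.symm (key b hb a ha h)

/-- A scale factor expressed in a new time coordinate. -/
theorem exists_isScaleFactor_comp {θ C : ℝ → ℝ} (hI : IsOpenInterval I) (hθ : ContDiffOn ℝ ∞ θ I)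
    (hd : ∀ t ∈ I, deriv θ t ≠ 0) (hC : IsScaleFactor I C) :
    ∃ D, IsScaleFactor (θ '' I) D ∧ ∀ t ∈ I, D (θ t) = C t := by
  have hinj := injOn_of_deriv_ne_zero hI hθ hd
  have hD : ∀ t ∈ I, C (Function.invFunOn θ I (θ t)) = C t := fun t ht => by
    rw [hinj.leftInvOn_invFunOn ht]
  refine ⟨fun s => C (Function.invFunOn θ I s), ⟨?_, ?_⟩, hD⟩
  · rintro _ ⟨t, ht, rfl⟩
    have hc : ContDiffAt ℝ ∞ θ t := hθ.contDiffAt (hI.1.mem_nhds ht)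
    -- Smoothness of the global inverse is local: near `θ t` it can be replaced by the local inverse
    -- of the inverse function theorem, which takes values in `I`.
    have hf := (hasDerivAt_of_smoothOn hI.1 hθ ht).hasFDerivAt_equiv (hd t ht)
    have hn : (∞ : WithTop ℕ∞) ≠ 0 := by simp
    have hsm := hc.to_localInverse hf hn
    have hval : hc.localInverse hf hn (θ t) = t := hc.localInverse_apply_image hf hn
    have hright : ∀ᶠ y in nhds (θ t), θ (hc.localInverse hf hn y) = y :=
      (hc.hasStrictFDerivAt' hf hn).eventually_right_inverse
    have hmem : ∀ᶠ y in nhds (θ t), hc.localInverse hf hn y ∈ I :=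
      hsm.continuousAt.eventually_mem (by rw [hval]; exact hI.1.mem_nhds ht)
    have hcomp : ContDiffAt ℝ ∞ (fun y => C (hc.localInverse hf hn y)) (θ t) := by
      refine ContDiffAt.comp (θ t) ?_ hsm
      rw [hval]; exact hC.1.contDiffAt (hI.1.mem_nhds ht)
    refine (hcomp.congr_of_eventuallyEq ?_).contDiffWithinAt
    filter_upwards [hright, hmem] with y hy hy'
    rw [← hD _ hy', hy]
  · rintro _ ⟨t, ht, rfl⟩
    change C _ ≠ 0
    rw [hD t ht]; exact hC.2 t ht

/-- At a zero of `F` all `α_i` equal `F'`, and equal `α_i`, `α_j` give `(H_i - H_j) F = 0` on `I`.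
Both alternatives rest on this. -/
theorem DiagonalCKV.trivial_or_ne_zero {X : Pt → Pt} {ψ : Pt → ℝ} {F : ℝ → ℝ} {α κ : Fin 4 → ℝ}
    (hI : IsOpenInterval I) (hG : ∀ i, IsScaleFactor I (G i))
    (hLRS : ¬ IsLRSOn (diagMetric G) (region I V)) (h : DiagonalCKV I V G X ψ F α κ) :
    (∀ t ∈ I, F t = 0) ∨
      ((∀ t ∈ I, F t ≠ 0) ∧ ∀ i j, i ≠ 0 → j ≠ 0 → i ≠ j → α i ≠ α j) := by
  by_cases hz : ∃ t ∈ I, F t = 0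
  · left
    obtain ⟨t₀, ht₀, h0⟩ := hz
    have hα : α 2 = α 1 := by
      have e₁ := h.eq t₀ ht₀ 1 (by decide)
      have e₂ := h.eq t₀ ht₀ 2 (by decide)
      rw [h0] at e₁ e₂
      linear_combination e₁ - e₂
    obtain ⟨s, hs, hs0⟩ := exists_rate_ne hI hG hLRS (i := 1) (j := 2) (by decide) (by decide)
      (by decide)
    -- The rates differ on a neighbourhood of `s`, so `F` vanishes there together with its
    -- derivative, and the common value `α 1` must be `0`.
    have hev : F =ᶠ[nhds s] fun _ => 0 := by
      have hcont := (continuousOn_rate_sub hI.1 hG 1 2).continuousAt (hI.1.mem_nhds hs)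
      filter_upwards [hI.1.mem_nhds hs, hcont.eventually_ne hs0] with t ht hne
      refine (mul_eq_zero.mp ?_).resolve_left hne
      linear_combination h.eq t ht 2 (by decide) - h.eq t ht 1 (by decide) + hα
    have hα0 : α 1 = 0 := by
      have := h.eq s hs 1 (by decide)
      rw [hev.deriv_eq, hev.eq_of_nhds] at this
      simpa using this.symm
    refine eq_zero_of_linear_ode hI (continuousOn_rate_sub hI.1 hG 1 0) (fun t ht => ?_) ht₀ h0
    refine (hasDerivAt_of_smoothOn hI.1 h.smooth ht).congr_deriv ?_
    rw [h.eq t ht 1 (by decide), hα0, add_zero]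
  · right
    push Not at hz
    refine ⟨hz, fun i j hi hj hij hα => ?_⟩
    obtain ⟨s, hs, hs0⟩ := exists_rate_ne hI hG hLRS hi hj hij
    refine hs0 ((mul_eq_zero.mp ?_).resolve_right (hz s hs))
    linear_combination h.eq s hs j hj - h.eq s hs i hi - hα

theorem pullback_coordChange {θ : ℝ → ℝ} {σ : Equiv.Perm (Fin 3)} {k : Fin 3 → ℝ}
    {G' : Fin 4 → ℝ → ℝ} (hθ : DifferentiableAt ℝ θ (p 0))
    (h0 : deriv θ (p 0) ^ 2 * G' 0 (θ (p 0)) = G 0 (p 0))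
    (hs : ∀ i : Fin 3, k i ^ 2 * G' i.succ (θ (p 0)) = G (σ i).succ (p 0)) :
    pullback (coordChange θ σ k) (diagMetric G') p = diagMetric G p := by
  have e0 : ∀ a, pd a (fun q => coordChange θ σ k q 0) p = if a = 0 then deriv θ (p 0) else 0 :=
    fun a => pd_comp_coord a 0 hθ
  have es : ∀ a (i : Fin 3), pd a (fun q => coordChange θ σ k q i.succ) p
      = if a = (σ i).succ then k i else 0 := by
    intro a i
    have : (fun q => coordChange θ σ k q i.succ) = fun q : Pt => k i * q (σ i).succ := by
      fin_cases i <;> rfl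
    rw [this, pd_comp_coord (h := fun s => k i * s) a _ (by fun_prop)]
    simp
  have hΦ : coordChange θ σ k p 0 = θ (p 0) := rfl
  ext a b
  simp only [pullback, Matrix.of_apply, diagMetric_apply, mul_ite, mul_zero, Finset.sum_ite_eq,
    Finset.mem_univ, if_true, hΦ]
  rw [Fin.sum_univ_succ]
  simp only [e0, es]
  refine Fin.cases ?_ (fun a' => ?_) a
  · refine Fin.cases ?_ (fun b' => ?_) b
    · simp [← h0, sq, (Fin.succ_ne_zero _).symm]
    · simp [(Fin.succ_ne_zero _).symm]
  · obtain ⟨a', rfl⟩ := σ.surjective a'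
    refine Fin.cases ?_ (fun b' => ?_) b
    · simp [(Fin.succ_ne_zero _).symm]
    · obtain ⟨b', rfl⟩ := σ.surjective b'
      by_cases hab : a' = b'
      · subst hab
        simp [← hs, sq]
      · simp [hab]

/-- The entries of a Bianchi I metric with scale factors `a i`. -/
def bianchiEntries (a : Fin 3 → ℝ → ℝ) : Fin 4 → ℝ → ℝ :=
  Fin.cons (fun _ => -1) fun i t => a i t ^ 2

theorem bianchiMetric_eq (A B C : ℝ → ℝ) :
    bianchiMetric A B C = diagMetric (bianchiEntries ![A, B, C]) := by
  funext p
  rw [bianchiMetric, diagMetric]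
  congr 1
  funext i
  fin_cases i <;> rfl

theorem isScaleFactor_bianchiEntries {a : Fin 3 → ℝ → ℝ} (ha : ∀ i, IsScaleFactor I (a i))
    (i : Fin 4) : IsScaleFactor I (bianchiEntries a i) := by
  refine Fin.cases ?_ (fun i => ?_) i
  · exact ⟨contDiffOn_const, fun t _ => by norm_num [bianchiEntries]⟩
  · exact ⟨(ha i).1.pow 2, fun t ht => pow_ne_zero 2 ((ha i).2 t ht)⟩

theorem rate_bianchiEntries_zero (a : Fin 3 → ℝ → ℝ) (t : ℝ) : rate (bianchiEntries a) 0 t = 0 := by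
  simp [rate, bianchiEntries]

theorem rate_bianchiEntries_succ {a : Fin 3 → ℝ → ℝ} (hI : IsOpen I)
    (ha : ∀ i, IsScaleFactor I (a i)) (i : Fin 3) {t : ℝ} (ht : t ∈ I) :
    rate (bianchiEntries a) i.succ t = deriv (a i) t / a i t := by
  have h0 := (ha i).2 t ht
  refine rate_eq_of_hasDerivAt ?_ (pow_ne_zero 2 h0)
  refine ((hasDerivAt_of_smoothOn hI (ha i).1 ht).pow 2).congr_deriv ?_
  simp only [bianchiEntries, Fin.cons_succ]
  field_simp
  simp
  ring

/-- The equations satisfied by the time component of a conformal Killing vector of a Bianchi I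
metric. -/
theorem DiagonalCKV.hasDerivAt_bianchi {a : Fin 3 → ℝ → ℝ} {X : Pt → Pt} {ψ : Pt → ℝ} {F : ℝ → ℝ}
    {α κ : Fin 4 → ℝ} (hI : IsOpen I) (ha : ∀ i, IsScaleFactor I (a i))
    (h : DiagonalCKV I V (bianchiEntries a) X ψ F α κ) (i : Fin 3) {t : ℝ} (ht : t ∈ I) :
    deriv F t = deriv (a i) t / a i t * F t + α i.succ := by
  rw [h.eq t ht i.succ (Fin.succ_ne_zero i), rate_bianchiEntries_succ hI ha i ht,
    rate_bianchiEntries_zero, sub_zero]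

theorem hasDerivAt_abs_rpow {t t₀ : ℝ} (q : ℝ) (ht : t ≠ t₀) :
    HasDerivAt (fun s => |s - t₀| ^ q) (q / (t - t₀) * |t - t₀| ^ q) t := by
  have h0 : t - t₀ ≠ 0 := sub_ne_zero.2 ht
  -- `Real.log` ignores the sign of its argument, so both sides of `t₀` are treated at once.
  have hE : ∀ s, s ≠ t₀ → |s - t₀| ^ q = Real.exp (Real.log (s - t₀) * q) := fun s hs => by
    rw [Real.rpow_def_of_pos (abs_pos.2 (sub_ne_zero.2 hs)), Real.log_abs]
  have hd := ((((hasDerivAt_id t).sub_const t₀).log h0).mul_const q).exp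
  refine (hd.congr_of_eventuallyEq ?_).congr_deriv ?_
  · filter_upwards [isOpen_ne.mem_nhds ht] with s hs using hE s hs
  · rw [hE t ht]; simp only [id]; ring

end TimeChange

/-! ### Bianchi I metrics with a conformal Killing vector -/

section BianchiClassification

variable {I : Set ℝ} {V : Set (Fin 3 → ℝ)} {a : Fin 3 → ℝ → ℝ} {X : Pt → Pt} {ψ : Pt → ℝ}
  {F : ℝ → ℝ} {α κ : Fin 4 → ℝ}

/-- With `α 3 = 0` both `F` and `a 2` solve the same linear equation, so `F = c₀ * a 2`. The axis
with `α = 0` is already the last one, so no permutation is needed. -/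
theorem belongsB1_of_diagonalCKV (hI : IsOpenInterval I) (ha : ∀ i, IsScaleFactor I (a i))
    (h : DiagonalCKV I V (bianchiEntries a) X ψ F α κ) (hF : ∀ t ∈ I, F t ≠ 0)
    (hα : ∀ i j, i ≠ 0 → j ≠ 0 → i ≠ j → α i ≠ α j) (h3 : α 3 = 0) :
    BelongsB1 I (diagMetric (bianchiEntries a)) := by
  have hd : ∀ i, ∀ t ∈ I, HasDerivAt (a i) (deriv (a i) t) t :=
    fun i t ht => hasDerivAt_of_smoothOn hI.1 (ha i).1 ht
  have heq : ∀ i : Fin 3, ∀ t ∈ I, deriv F t = deriv (a i) t / a i t * F t + α i.succ :=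
    fun i t ht => h.hasDerivAt_bianchi hI.1 ha i ht
  have h1 : α 1 ≠ 0 := h3 ▸ hα 1 3 (by decide) (by decide) (by decide)
  have h2 : α 2 ≠ 0 := h3 ▸ hα 2 3 (by decide) (by decide) (by decide)
  have h12 : α 2 ≠ α 1 := hα 2 1 (by decide) (by decide) (by decide)
  obtain ⟨c₀, hc₀⟩ := exists_eq_mul_of_linear_ode (y := F) (z := a 2)
    (h := fun t => deriv (a 2) t / a 2 t) hI
    (fun t ht => (hasDerivAt_of_smoothOn hI.1 h.smooth ht).congr_deriv (by
      rw [heq 2 t ht]; change _ + α 3 = _; rw [h3, add_zero]))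
    (fun t ht => (hd 2 t ht).congr_deriv (by have := (ha 2).2 t ht; field_simp)) (ha 2).2
  have hc : c₀ ≠ 0 := by
    rintro rfl
    obtain ⟨t, ht⟩ := hI.2.2
    exact hF t ht (by rw [hc₀ t ht, zero_mul])
  -- Since `(log (a 0 / a 2))' = -α 1 / (c₀ * a 2)`, this is conformal time, `θ' = 1 / a 2`,
  -- obtained without integration. The first spatial coefficient then has the required form with
  -- rescaling `1`.
  set θ : ℝ → ℝ := fun t => -(c₀ / α 1) * (Real.log (a 0 t) - Real.log (a 2 t)) with hθ
  have hθd : ∀ t ∈ I, HasDerivAt θ (1 / a 2 t) t := fun t ht => by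
    refine ((((hd 0 t ht).log ((ha 0).2 t ht)).sub ((hd 2 t ht).log ((ha 2).2 t ht))).const_mul
      (-(c₀ / α 1))).congr_deriv ?_
    have e₀ := heq 0 t ht
    have e₂ := heq 2 t ht
    change _ = _ + α 1 at e₀
    change _ = _ + α 3 at e₂
    rw [hc₀ t ht, h3] at e₂
    rw [e₂, hc₀ t ht] at e₀
    have n₀ := (ha 0).2 t ht
    have n₂ := (ha 2).2 t ht
    field_simp at e₀ ⊢
    linear_combination e₀
  have hθs : ContDiffOn ℝ ∞ θ I :=
    contDiffOn_const.mul (((ha 0).1.log (ha 0).2).sub ((ha 2).1.log (ha 2).2))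
  have hθ0 : ∀ t ∈ I, deriv θ t ≠ 0 := fun t ht => by
    rw [(hθd t ht).deriv]; exact one_div_ne_zero ((ha 2).2 t ht)
  obtain ⟨D, hD, hDθ⟩ := exists_isScaleFactor_comp hI hθs hθ0 (ha 2)
  set y : ℝ → ℝ := fun t => a 2 t * Real.exp (-(α 2 / c₀) * θ t) with hy
  obtain ⟨k, hk⟩ := exists_eq_mul_of_linear_ode (y := a 1) (z := y)
    (h := fun t => deriv (a 1) t / a 1 t) hI
    (fun t ht => (hd 1 t ht).congr_deriv (by have := (ha 1).2 t ht; field_simp))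
    (fun t ht => by
      refine ((hd 2 t ht).mul (((hθd t ht).const_mul (-(α 2 / c₀))).exp)).congr_deriv ?_
      have e₁ := heq 1 t ht
      have e₂ := heq 2 t ht
      change _ = _ + α 2 at e₁
      change _ = _ + α 3 at e₂
      rw [hc₀ t ht, h3] at e₂
      rw [e₂, hc₀ t ht] at e₁
      have n₁ := (ha 1).2 t ht
      have n₂ := (ha 2).2 t ht
      have e₃ : deriv (a 2) t - α 2 / c₀ = deriv (a 1) t / a 1 t * a 2 t := by
        field_simp at e₁ ⊢
        linear_combination e₁
      rw [hy]
      dsimp only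
      rw [← mul_assoc (deriv (a 1) t / a 1 t), ← e₃]
      field_simp
      ring)
    (fun t ht => mul_ne_zero ((ha 2).2 t ht) (Real.exp_ne_zero _))
  have hk0 : k ≠ 0 := by
    rintro rfl
    obtain ⟨t, ht⟩ := hI.2.2
    exact (ha 1).2 t ht (by rw [hk t ht, zero_mul])
  -- The field is divided by `α 1` so that its `x`-coefficient is `1`; its `τ`-component becomes `F
  -- * θ' / α 1 = c₀ / α 1`.
  refine ⟨c₀ / α 1, α 2 / α 1, D, θ, ⟨div_ne_zero hc h1, div_ne_zero h2 h1, ?_⟩, hD, hθs, hθ0, 1,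
    ![1, k, 1], ?_, fun p hp => ?_⟩
  · rw [Ne, div_eq_one_iff_eq h1]; exact h12
  · intro i; fin_cases i <;> simp [hk0]
  · rw [metricB1_eq]
    have n₂ := (ha 2).2 _ hp
    refine pullback_coordChange (hθd _ hp).differentiableAt ?_ fun i => ?_
    · rw [(hθd _ hp).deriv]
      simp only [conformalEntries, hDθ _ hp, entriesB1, bianchiEntries, Matrix.cons_val_zero,
        Fin.cons_zero]
      field_simp
    · fin_cases i
      · have n₀ := (ha 0).2 _ hp
        have : Real.exp (-(2 / (c₀ / α 1)) * θ (p 0)) = a 0 (p 0) ^ 2 / a 2 (p 0) ^ 2 := by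
          have e : -(2 / (c₀ / α 1)) * θ (p 0)
              = Real.log (a 0 (p 0) ^ 2) - Real.log (a 2 (p 0) ^ 2) := by
            rw [Real.log_pow, Real.log_pow, hθ]
            field_simp
            push_cast
            ring
          rw [e, Real.exp_sub, Real.exp_log (by positivity), Real.exp_log (by positivity)]
        change (1 : ℝ) ^ 2 * (D (θ (p 0)) ^ 2 * Real.exp (-(2 / (c₀ / α 1)) * θ (p 0)))
          = a 0 (p 0) ^ 2
        rw [this, hDθ _ hp]
        field_simp
      · change k ^ 2 * (D (θ (p 0)) ^ 2 * Real.exp (-(2 * (α 2 / α 1) / (c₀ / α 1)) * θ (p 0)))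
          = a 1 (p 0) ^ 2
        have e : -(2 * (α 2 / α 1) / (c₀ / α 1)) * θ (p 0)
            = -(α 2 / c₀) * θ (p 0) + -(α 2 / c₀) * θ (p 0) := by
          field_simp
          ring
        rw [hDθ _ hp, e, Real.exp_add, hk _ hp, hy]
        ring
      · change (1 : ℝ) ^ 2 * (D (θ (p 0)) ^ 2 * 1) = a 2 (p 0) ^ 2
        rw [hDθ _ hp]
        ring

/-- Here `F / (α 3 * a 2)` has derivative `1 / a 2`, so up to sign it serves as conformal time. -/
theorem belongsB2_of_diagonalCKV (hI : IsOpenInterval I) (ha : ∀ i, IsScaleFactor I (a i))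
    (h : DiagonalCKV I V (bianchiEntries a) X ψ F α κ) (hF : ∀ t ∈ I, F t ≠ 0)
    (hα : ∀ i j, i ≠ 0 → j ≠ 0 → i ≠ j → α i ≠ α j) (h3 : α 3 ≠ 0) :
    BelongsB2 I (diagMetric (bianchiEntries a)) := by
  -- The normalization divides by the coefficient of the new `x`-axis. At most one `α_i` is zero, so
  -- exchanging the first two axes suffices.
  obtain ⟨σ, hσ2, hσ⟩ : ∃ σ : Equiv.Perm (Fin 3), σ 2 = 2 ∧ α (σ 0).succ ≠ 0 := by
    by_cases h1 : α 1 = 0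
    · exact ⟨Equiv.swap 0 1, by decide, h1 ▸ hα 2 1 (by decide) (by decide) (by decide)⟩
    · exact ⟨1, rfl, h1⟩
  have hd : ∀ i, ∀ t ∈ I, HasDerivAt (a i) (deriv (a i) t) t :=
    fun i t ht => hasDerivAt_of_smoothOn hI.1 (ha i).1 ht
  have heq : ∀ i : Fin 3, ∀ t ∈ I, deriv F t = deriv (a i) t / a i t * F t + α i.succ :=
    fun i t ht => h.hasDerivAt_bianchi hI.1 ha i ht
  have hα' : ∀ i j : Fin 3, i ≠ j → α (σ i).succ ≠ α (σ j).succ := fun i j hij =>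
    hα _ _ (Fin.succ_ne_zero _) (Fin.succ_ne_zero _)
      fun e => hij (σ.injective (Fin.succ_injective _ e))
  have hα3 : α (σ 2).succ = α 3 := by rw [hσ2]; rfl
  have hwd : ∀ t ∈ I, HasDerivAt (fun t => F t / (α 3 * a 2 t)) (1 / a 2 t) t := fun t ht => by
    have n₂ := (ha 2).2 t ht
    refine ((hasDerivAt_of_smoothOn hI.1 h.smooth ht).div ((hd 2 t ht).const_mul (α 3))
      (mul_ne_zero h3 n₂)).congr_deriv ?_
    have e₂ := heq 2 t ht
    change _ = _ + α 3 at e₂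
    rw [e₂]
    field_simp
    ring
  -- The candidate time has no zeros on the interval, hence a constant sign `s`. The metric sees
  -- only `θ' ^ 2`, which is unaffected by `s`.
  obtain ⟨s, hs, hpos⟩ : ∃ s : ℝ, s ^ 2 = 1 ∧ ∀ t ∈ I, 0 < s * (F t / (α 3 * a 2 t)) := by
    have hne : ∀ t ∈ I, F t / (α 3 * a 2 t) ≠ 0 := fun t ht =>
      div_ne_zero (hF t ht) (mul_ne_zero h3 ((ha 2).2 t ht))
    have hcont : ContinuousOn (fun t => F t / (α 3 * a 2 t)) I := fun t ht =>
      (hwd t ht).continuousAt.continuousWithinAt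
    by_cases hp : ∀ t ∈ I, 0 < F t / (α 3 * a 2 t)
    · exact ⟨1, by norm_num, fun t ht => by rw [one_mul]; exact hp t ht⟩
    · push Not at hp
      obtain ⟨u, hu, hu0⟩ := hp
      refine ⟨-1, by norm_num, fun t ht => ?_⟩
      by_contra hcon
      obtain ⟨r, hr, hr0⟩ := hI.isPreconnected.intermediate_value hu ht hcont
        (show (0 : ℝ) ∈ _ from ⟨hu0, by linarith⟩)
      exact hne r hr hr0
  have hs0 : s ≠ 0 := fun h => by rw [h] at hs; norm_num at hs
  set θ : ℝ → ℝ := fun t => s * (F t / (α 3 * a 2 t)) with hθ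
  have hθd : ∀ t ∈ I, HasDerivAt θ (s * (1 / a 2 t)) t := fun t ht => (hwd t ht).const_mul s
  have hθs : ContDiffOn ℝ ∞ θ I :=
    contDiffOn_const.mul (h.smooth.div (contDiffOn_const.mul (ha 2).1)
      fun t ht => mul_ne_zero h3 ((ha 2).2 t ht))
  have hθ0 : ∀ t ∈ I, deriv θ t ≠ 0 := fun t ht => by
    rw [(hθd t ht).deriv]; exact mul_ne_zero hs0 (one_div_ne_zero ((ha 2).2 t ht))
  obtain ⟨D, hD, hDθ⟩ := exists_isScaleFactor_comp hI hθs hθ0 (ha 2)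
  have hpow : ∀ i : Fin 3, ∃ k : ℝ, k ≠ 0 ∧ ∀ t ∈ I,
      a i t = k * (a 2 t * θ t ^ ((α 3 - α i.succ) / α 3)) := by
    intro i
    have hy0 : ∀ t ∈ I, a 2 t * θ t ^ ((α 3 - α i.succ) / α 3) ≠ 0 := fun t ht =>
      mul_ne_zero ((ha 2).2 t ht) (Real.rpow_pos_of_pos (hpos t ht) _).ne'
    obtain ⟨k, hk⟩ := exists_eq_mul_of_linear_ode (y := a i)
      (z := fun t => a 2 t * θ t ^ ((α 3 - α i.succ) / α 3))
      (h := fun t => deriv (a i) t / a i t) hI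
      (fun t ht => (hd i t ht).congr_deriv (by have := (ha i).2 t ht; field_simp))
      (fun t ht => by
        have hr := (hasDerivAt_rpow_of_pos ((α 3 - α i.succ) / α 3) (hpos t ht)).comp t (hθd t ht)
        refine ((hd 2 t ht).mul hr).congr_deriv ?_
        have e₁ := heq i t ht
        have e₂ := heq 2 t ht
        change _ = _ + α 3 at e₂
        have n₁ := (ha i).2 t ht
        have n₂ := (ha 2).2 t ht
        have nF := hF t ht
        -- The equations of axis `i` and of the last axis are subtracted. As `F = s * α 3 * a 2 *
        -- θ`, the ratio `a i / a 2` has the logarithmic derivative of a power of `θ`.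
        have e₃ : deriv (a i) t / a i t = deriv (a 2) t / a 2 t + (α 3 - α i.succ) / F t := by
          refine mul_right_cancel₀ nF ?_
          rw [add_mul, div_mul_cancel₀ _ nF]
          linear_combination e₂ - e₁
        have e₄ : (α 3 - α i.succ) / α 3 / θ t = (α 3 - α i.succ) * a 2 t / (s * F t) := by
          rw [hθ]; field_simp
        change deriv (a 2) t * θ t ^ ((α 3 - α i.succ) / α 3) + a 2 t * ((α 3 - α i.succ) / α 3 / θ t
          * θ t ^ ((α 3 - α i.succ) / α 3) * (s * (1 / a 2 t))) = _
        rw [e₃, e₄]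
        field_simp) hy0
    refine ⟨k, ?_, hk⟩
    rintro rfl
    obtain ⟨t, ht⟩ := hI.2.2
    exact (ha i).2 t ht (by rw [hk t ht, zero_mul])
  obtain ⟨k₀, hk₀, e₀⟩ := hpow (σ 0)
  obtain ⟨k₁, hk₁, e₁⟩ := hpow (σ 1)
  have hn := hα' 2 0 (by decide)
  have hn' := hα' 1 2 (by decide)
  have hn'' := hα' 1 0 (by decide)
  rw [hα3] at hn hn'
  refine ⟨α (σ 1).succ / α (σ 0).succ, α 3 / α (σ 0).succ, D, θ,
    ⟨div_ne_zero h3 hσ, ?_, ?_, ?_⟩, ?_, hD, hθs, hθ0, σ, ![k₀, k₁, 1], ?_, fun p hp => ?_⟩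
  · rwa [Ne, div_eq_one_iff_eq hσ]
  · rwa [Ne, div_left_inj' hσ]
  · rwa [Ne, div_eq_one_iff_eq hσ]
  · rintro _ ⟨t, ht, rfl⟩
    exact hpos t ht
  · intro i; fin_cases i <;> simp [hk₀, hk₁]
  · rw [metricB2_eq]
    have n₂ := (ha 2).2 _ hp
    have hsq : ∀ m : ℝ, θ (p 0) ^ (2 * m) = (θ (p 0) ^ m) ^ 2 := fun m => by
      rw [two_mul, Real.rpow_add (hpos _ hp), sq]
    refine pullback_coordChange (hθd _ hp).differentiableAt ?_ fun i => ?_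
    · rw [(hθd _ hp).deriv]
      simp only [conformalEntries, hDθ _ hp, entriesB2, bianchiEntries, Matrix.cons_val_zero,
        Fin.cons_zero, mul_pow, hs]
      field_simp
    · fin_cases i
      · change k₀ ^ 2 * (D (θ (p 0)) ^ 2 * θ (p 0)
          ^ (2 * ((α 3 / α (σ 0).succ - 1) / (α 3 / α (σ 0).succ)))) = a (σ 0) (p 0) ^ 2
        have e : (α 3 / α (σ 0).succ - 1) / (α 3 / α (σ 0).succ)
            = (α 3 - α (σ 0).succ) / α 3 := by field_simp
        rw [hDθ _ hp, hsq, e, e₀ _ hp]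
        ring
      · change k₁ ^ 2 * (D (θ (p 0)) ^ 2 * θ (p 0)
          ^ (2 * ((α 3 / α (σ 0).succ - α (σ 1).succ / α (σ 0).succ) / (α 3 / α (σ 0).succ))))
            = a (σ 1) (p 0) ^ 2
        have e : (α 3 / α (σ 0).succ - α (σ 1).succ / α (σ 0).succ) / (α 3 / α (σ 0).succ)
            = (α 3 - α (σ 1).succ) / α 3 := by field_simp
        rw [hDθ _ hp, hsq, e, e₁ _ hp]
        ring
      · change (1 : ℝ) ^ 2 * (D (θ (p 0)) ^ 2 * 1) = a (σ 2) (p 0) ^ 2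
        rw [hDθ _ hp, hσ2]
        ring

theorem belongs_of_isProperCKV (hI : IsOpenInterval I) (hV : IsOpen V) (hVc : IsConnected V)
    (ha : ∀ i, IsScaleFactor I (a i)) (hLRS : ¬ IsLRSOn (diagMetric (bianchiEntries a)) (region I V))
    (hCF : ¬ ConformallyFlatOn (diagMetric (bianchiEntries a)) (region I V))
    (hX : IsProperCKV (diagMetric (bianchiEntries a)) (region I V) X) :
    BelongsB1 I (diagMetric (bianchiEntries a)) ∨ BelongsB2 I (diagMetric (bianchiEntries a)) := by
  obtain ⟨ψ, hX, hψ⟩ := hX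
  have hG := isScaleFactor_bianchiEntries ha
  obtain ⟨F, α, κ, h⟩ := hX.exists_diagonalCKV hI hV hVc hG hLRS hCF
  rcases h.trivial_or_ne_zero hI hG hLRS with hF | ⟨hF, hα⟩
  · refine absurd ⟨0, fun p hp => ?_⟩ hψ
    have hE : EqOn F (fun _ => 0) I := hF
    rw [h.factor p hp, hE.deriv hI.1 hp.1, hF _ hp.1]
    simp
  · by_cases h3 : α 3 = 0
    · exact Or.inl (belongsB1_of_diagonalCKV hI ha h hF hα h3)
    · exact Or.inr (belongsB2_of_diagonalCKV hI ha h hF hα h3)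

/-- Since `H_0 = 0`, the conformal factor is `F'`. So `F` is affine with root `t₀`, which lies
outside `I` because `F` has no zeros, and each `a_i' / a_i` is a constant over `t - t₀`. -/
theorem exists_powerLaw_of_isProperHV (hI : IsOpenInterval I) (hV : IsOpen V)
    (hVc : IsConnected V) (ha : ∀ i, IsScaleFactor I (a i))
    (hLRS : ¬ IsLRSOn (diagMetric (bianchiEntries a)) (region I V))
    (hCF : ¬ ConformallyFlatOn (diagMetric (bianchiEntries a)) (region I V))
    (hX : IsProperHV (diagMetric (bianchiEntries a)) (region I V) X) :
    ∃ t₀ ∉ I, ∀ i, ∃ b q : ℝ, ∀ t ∈ I, a i t = b * |t - t₀| ^ q := by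
  obtain ⟨k, hk, hX⟩ := hX
  have hG := isScaleFactor_bianchiEntries ha
  obtain ⟨F, α, κ, h⟩ := hX.exists_diagonalCKV hI hV hVc hG hLRS hCF
  have hFd : ∀ t ∈ I, deriv F t = k := (forall_mem_region (P := fun t => deriv F t = k)
    hVc.nonempty).1 fun p hp => by
      have := h.factor p hp
      rw [rate_bianchiEntries_zero, zero_mul, add_zero] at this
      exact this.symm
  obtain ⟨d, hd⟩ := eqOn_const_of_hasDerivAt (y := fun t => F t - k * t) hI fun t ht =>
    ((hasDerivAt_of_smoothOn hI.1 h.smooth ht).sub ((hasDerivAt_id t).const_mul k)).congr_deriv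
      (by rw [hFd t ht]; ring)
  have hFt : ∀ t ∈ I, F t = k * (t - -(d / k)) := fun t ht => by
    field_simp
    linear_combination hd t ht
  have hF0 : ∀ t ∈ I, F t ≠ 0 := by
    rcases h.trivial_or_ne_zero hI hG hLRS with hF | ⟨hF, -⟩
    · exfalso
      obtain ⟨t, ht⟩ := hI.2.2
      have hE : EqOn F (fun _ => 0) I := hF
      have := hFd t ht
      rw [hE.deriv hI.1 ht] at this
      exact hk (by simpa using this.symm)
    · exact hF
  have ht₀ : -(d / k) ∉ I := fun hmem => hF0 _ hmem (by rw [hFt _ hmem, sub_self, mul_zero])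
  have hne : ∀ t ∈ I, t ≠ -(d / k) := fun t ht e => ht₀ (e ▸ ht)
  refine ⟨-(d / k), ht₀, fun i => ?_⟩
  obtain ⟨b, hb⟩ := exists_eq_mul_of_linear_ode (y := a i)
    (z := fun t => |t - -(d / k)| ^ ((k - α i.succ) / k))
    (h := fun t => (k - α i.succ) / k / (t - -(d / k))) hI
    (fun t ht => (hasDerivAt_of_smoothOn hI.1 (ha i).1 ht).congr_deriv (by
      have e := h.hasDerivAt_bianchi hI.1 ha i ht
      have n := (ha i).2 t ht
      have n' : t - -(d / k) ≠ 0 := sub_ne_zero.2 (hne t ht)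
      rw [hFd t ht, hFt t ht] at e
      have e' : deriv (a i) t / a i t = (k - α i.succ) / k / (t - -(d / k)) := by
        rw [div_div, eq_div_iff (mul_ne_zero hk n')]
        linear_combination -e
      rw [← e', div_mul_cancel₀ _ n]))
    (fun t ht => hasDerivAt_abs_rpow _ (hne t ht))
    (fun t ht => (Real.rpow_pos_of_pos (abs_pos.2 (sub_ne_zero.2 (hne t ht))) _).ne')
  exact ⟨b, _, hb⟩

theorem exists_isProperHV_of_powerLaw (hI : IsOpen I) (hV : IsOpen V)
    (ha : ∀ i, IsScaleFactor I (a i)) {t₀ : ℝ} (ht₀ : t₀ ∉ I) {b q : Fin 3 → ℝ}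
    (h : ∀ i, ∀ t ∈ I, a i t = b i * |t - t₀| ^ q i) :
    ∃ X, IsProperHV (diagMetric (bianchiEntries a)) (region I V) X := by
  have hG := isScaleFactor_bianchiEntries ha
  -- The scaling field, normalized to conformal factor `1`; `F = t - t₀` and `a_i' / a_i = q_i / (t
  -- - t₀)` force `α_i = 1 - q_i`.
  refine ⟨fun p => Fin.cons (p 0 - t₀) fun i => (1 - q i) * p i.succ, 1, one_ne_zero, ?_⟩
  refine DiagonalCKV.isCKV (F := fun t => t - t₀) (α := Fin.cons 0 fun i => 1 - q i) (κ := 0)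
    hI hV hG ⟨(contDiff_id.sub contDiff_const).contDiffOn, fun p _ => rfl, fun p _ i hi => ?_,
      fun t ht i hi => ?_, fun p hp => ?_⟩
  · obtain ⟨i, rfl⟩ := Fin.exists_succ_eq.2 hi
    simp
  · obtain ⟨i, rfl⟩ := Fin.exists_succ_eq.2 hi
    have hne : t ≠ t₀ := fun e => ht₀ (e ▸ ht)
    have n' : t - t₀ ≠ 0 := sub_ne_zero.2 hne
    have hE : EqOn (a i) (fun t => b i * |t - t₀| ^ q i) I := h i
    have hd : deriv (a i) t / a i t = q i / (t - t₀) := by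
      rw [div_eq_iff ((ha i).2 t ht), hE.deriv hI ht,
        ((hasDerivAt_abs_rpow (q i) hne).const_mul (b i)).deriv, h i t ht]
      ring
    rw [rate_bianchiEntries_succ hI ha i ht, rate_bianchiEntries_zero, hd]
    simp
    field_simp
    ring
  · rw [rate_bianchiEntries_zero]
    simp

end BianchiClassification

end BianchiI

theorem mainTheorem3 :
    -- Bianchi I metrics that are neither LRS nor conformally flat
    (∀ (I : Set ℝ) (V : Set (Fin 3 → ℝ)) (A B C : ℝ → ℝ),
      BianchiI.IsOpenInterval I → IsOpen V → IsConnected V →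
      BianchiI.IsScaleFactor I A → BianchiI.IsScaleFactor I B → BianchiI.IsScaleFactor I C →
      ¬ BianchiI.IsLRSOn (BianchiI.bianchiMetric A B C) (BianchiI.region I V) →
      ¬ BianchiI.ConformallyFlatOn (BianchiI.bianchiMetric A B C) (BianchiI.region I V) →
      -- a proper CKV exists only in the two families
      ((∃ X, BianchiI.IsProperCKV (BianchiI.bianchiMetric A B C) (BianchiI.region I V) X) →
        BianchiI.BelongsB1 I (BianchiI.bianchiMetric A B C) ∨
        BianchiI.BelongsB2 I (BianchiI.bianchiMetric A B C)) ∧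
      -- a proper HV exists exactly for power-law coefficients
      ((∃ X, BianchiI.IsProperHV (BianchiI.bianchiMetric A B C) (BianchiI.region I V) X) ↔
        BianchiI.IsPowerLaw I A B C)) ∧
    -- the first family
    (∀ (c α₁ : ℝ) (J : Set ℝ) (V : Set (Fin 3 → ℝ)) (C : ℝ → ℝ),
      BianchiI.ParamsB1 c α₁ → BianchiI.IsOpenInterval J → IsOpen V → IsConnected V →
      BianchiI.IsScaleFactor J C →
      ¬ BianchiI.IsLRSOn (BianchiI.metricB1 c α₁ C) (BianchiI.region J V) ∧
      ¬ BianchiI.ConformallyFlatOn (BianchiI.metricB1 c α₁ C) (BianchiI.region J V) ∧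
      BianchiI.HasUniqueCKV (BianchiI.metricB1 c α₁ C) (BianchiI.region J V)
        (BianchiI.fieldB1 c α₁) (BianchiI.factorB1 c C) ∧
      (BianchiI.IsProperHV (BianchiI.metricB1 c α₁ C) (BianchiI.region J V)
          (BianchiI.fieldB1 c α₁) ↔
        ∃ ψ₀ k : ℝ, ψ₀ ≠ 0 ∧ ∀ τ ∈ J, C τ = k * Real.exp (ψ₀ * τ))) ∧
    -- the second family
    (∀ (α₁ α₂ : ℝ) (J : Set ℝ) (V : Set (Fin 3 → ℝ)) (C : ℝ → ℝ),
      BianchiI.ParamsB2 α₁ α₂ → BianchiI.IsOpenInterval J → J ⊆ Set.Ioi 0 →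
      IsOpen V → IsConnected V → BianchiI.IsScaleFactor J C →
      ¬ BianchiI.IsLRSOn (BianchiI.metricB2 α₁ α₂ C) (BianchiI.region J V) ∧
      ¬ BianchiI.ConformallyFlatOn (BianchiI.metricB2 α₁ α₂ C) (BianchiI.region J V) ∧
      BianchiI.HasUniqueCKV (BianchiI.metricB2 α₁ α₂ C) (BianchiI.region J V)
        (BianchiI.fieldB2 α₁ α₂) (BianchiI.factorB2 α₂ C) ∧
      (BianchiI.IsProperHV (BianchiI.metricB2 α₁ α₂ C) (BianchiI.region J V)
          (BianchiI.fieldB2 α₁ α₂) ↔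
        ∃ ψ₀ k : ℝ, ψ₀ ≠ 0 ∧ ∀ τ ∈ J, C τ = k * τ ^ (ψ₀ - 1))) := by
  refine ⟨fun I V A B C hI hV hVc hA hB hC hLRS hCF => ?_,
    fun c α₁ J V C hp hJ hV hVc hC => ⟨BianchiI.not_isLRSOn_B1 hp hJ hVc.nonempty hC,
      BianchiI.not_conformallyFlatOn_B1 hp hJ hVc.nonempty hC,
      BianchiI.hasUniqueCKV_B1 hp hJ hV hVc hC, BianchiI.isProperHV_B1_iff hp hJ hV hVc hC⟩,
    fun α₁ α₂ J V C hp hJ hJ0 hV hVc hC => ⟨BianchiI.not_isLRSOn_B2 hp hJ hJ0 hVc.nonempty hC,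
      BianchiI.not_conformallyFlatOn_B2 hp hJ hJ0 hVc.nonempty hC,
      BianchiI.hasUniqueCKV_B2 hp hJ hJ0 hV hVc hC,
      BianchiI.isProperHV_B2_iff hp hJ hJ0 hV hVc hC⟩⟩
  rw [BianchiI.bianchiMetric_eq] at *
  have ha : ∀ i, BianchiI.IsScaleFactor I ((![A, B, C] : Fin 3 → ℝ → ℝ) i) := by
    intro i; fin_cases i
    · exact hA
    · exact hB
    · exact hC
  refine ⟨fun ⟨X, hX⟩ => BianchiI.belongs_of_isProperCKV hI hV hVc ha hLRS hCF hX,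
    fun ⟨X, hX⟩ => ?_, ?_⟩
  · obtain ⟨t₀, ht₀, h⟩ := BianchiI.exists_powerLaw_of_isProperHV hI hV hVc ha hLRS hCF hX
    choose b q h using h
    exact ⟨t₀, ht₀, b 0, b 1, b 2, q 0, q 1, q 2, fun t ht => ⟨h 0 t ht, h 1 t ht, h 2 t ht⟩⟩
  · rintro ⟨t₀, ht₀, a, b, c, p, q, r, h⟩
    refine BianchiI.exists_isProperHV_of_powerLaw hI.1 hV ha ht₀ (b := ![a, b, c])
      (q := ![p, q, r]) fun i t ht => ?_
    fin_cases i
    · exact (h t ht).1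
    · exact (h t ht).2.1
    · exact (h t ht).2.2
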